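/- Let $d\ge 2$ and let $\mathcal K$ be a nonempty compact subset of $\{1,\dots,d-1\}\times \mathrm{GL}(d,\mathbb R)\times M_d(\mathbb R)\times M_d(\mathbb R)$, whose elements (modes) are written $\sigma=(\ell,P,\Lambda,R)$. For $\ell\in\{1,\dots,d-1\}$ and $\varepsilon\ge 0$ let $E_\ell^\varepsilon$ be the diagonal $d\times d$ matrix with the first $\ell$ diagonal entries equal to $1$ and the others equal to $\varepsilon$, and let $E_{\ell^c}^\varepsilon$ be the diagonal matrix with the first $\ell$ diagonal entries equal to $\varepsilon$ and the others equal to $1$. A signal in a set $\mathcal S$ consists of finitely or infinitely many (possibly no) switching times $0<t_1<t_2<\cdots$ without accumulation point, and of values $\sigma_k\in\mathcal S$ on $[t_k,t_{k+1})$, $k\ge 0$, where $t_0=0$ and $t_{n+1}=+\infty$ if there are exactly $n$ switching times; consecutive values may coincide. For $\varepsilon>0$, $\Sigma^\varepsilon_{\mathcal K}$ is the system, driven by signals $\sigma_k=(\ell_k,P_k,\Lambda_k,R_k)$ in $\mathcal K$, $$E^\varepsilon_{\ell_k}P_k\dot X(t)=\Lambda_kX(t)\ \ (t\in[t_k,t_{k+1}),\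 k\ge 0),\qquad X(t_k)=R_{k-1}X(t_k^-)\ \ (k\ge 1).$$ For a set $\mathcal Z\subset M_d(\mathbb R)\times M_d(\mathbb R)$, $\Delta_{\mathcal Z,0}$ is the system, driven by signals $(Z_{1,k},Z_{2,k})$ in $\mathcal Z$, $$\dot x(t)=Z_{1,k}x(t)\ \ (t\in[t_k,t_{k+1}),\ k\ge 0),\qquad x(t_k)=Z_{2,k-1}x(t_k^-)\ \ (k\ge 1).$$ For either system, let $\Phi_s(t,0)$ be the matrix that maps the initial condition at time $0$ to the solution at time $t$ for the signal $s$. The maximal Lyapunov exponent, in $[-\infty,+\infty]$, is $$\lambda=\limsup_{t\to+\infty}\ \sup_{s}\frac{\log\|\Phi_s(t,0)\|}{t},$$ where $\|\cdot\|$ is the operator norm induced by the Euclidean norm, $\log 0=-\infty$, and the supremum is over all signals $s$ in $\mathcal K$, respectively in $\mathcal Z$. Let $\alpha(M)$ denote the maximal real part of the complex eigenvalues of $M$. Then $$\liminf_{\varepsilon\searrow0}\varepsilon\lambda(\Sigma^\varepsilon_{\mathcal K})\ \ge\ \sup_{(\ell,P,\Lambda,R)\in\mathcal K}\alpha(P^{-1}E^0_{\ell^c}\Lambda)\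 \ge\ 0 .$$ If, moreover, there is a constant $C>0$ such that $\|R_k\cdots R_1\|\le C$ for every $k\ge 1$ and all $R_1,\dots,R_k\in\mathcal R=\{R\mid(\ell,P,\Lambda,R)\in\mathcal K\}$, then $$\lim_{\varepsilon\searrow0}\varepsilon\lambda(\Sigma^\varepsilon_{\mathcal K})=\max\bigl(0,\lambda(\Delta_{\mathcal Z,0})\bigr),\qquad \mathcal Z=\{(P^{-1}E^0_{\ell^c}\Lambda,R)\mid(\ell,P,\Lambda,R)\in\mathcal K\}.$$ -/

import Mathlib

open Filter Topology Matrix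

noncomputable section

namespace SingPert

/-- Real square matrices of size `d`. -/
abbrev Mat (d : ℕ) : Type := Matrix (Fin d) (Fin d) ℝ

/-- A piecewise-constant signal with values in `S`, given with its switching times and with dwell
time `τ`. There are `N ∈ {0, 1, 2, …, ∞}` switchings, at the times
`0 = time 0 < time 1 < time 2 < …` (`time k` is meaningful for `k ≤ N`, and switching times are the
`time k` with `1 ≤ k ≤ N`); they do not accumulate. On `[time k, time (k+1))`, or on
`[time N, ∞)` if `k = N`, the signal has the value `mode k`. Consecutive values may coincide. -/
structure Signal {α : Type*} (S : Set α) (τ : ℝ) where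
  N : ℕ∞
  time : ℕ → ℝ
  mode : ℕ → α
  time_zero : time 0 = 0
  time_lt : ∀ k : ℕ, ((k + 1 : ℕ) : ℕ∞) ≤ N → time k < time (k + 1)
  dwell : ∀ k : ℕ, ((k + 1 : ℕ) : ℕ∞) ≤ N → time k + τ ≤ time (k + 1)
  locally_finite : N = ⊤ → Tendsto time atTop atTop
  mode_mem : ∀ k : ℕ, (k : ℕ∞) ≤ N → mode k ∈ S

namespace Signal

variable {α : Type*} {S : Set α} {τ : ℝ} {d : ℕ}

/-- The number of switchings in `(0, t]`: the largest `k ≤ N` with `time k ≤ t`. -/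
def index (s : Signal S τ) (t : ℝ) : ℕ :=
  sSup {k : ℕ | (k : ℕ∞) ≤ s.N ∧ s.time k ≤ t}

/-- The flow from time `0` to time `time k` (the jump at `time k` included, for `k ≥ 1`) when mode
`a` has the generator `G a` and the jump matrix `R a`. -/
def flowAtSwitch (s : Signal S τ) (G R : α → Mat d) : ℕ → Mat d
  | 0 => 1
  | k + 1 => R (s.mode k) * NormedSpace.exp ((s.time (k + 1) - s.time k) • G (s.mode k)) *
      s.flowAtSwitch G R k

/-- The flow from time `0` to time `t ≥ 0` of the impulsive system `x' = G(mode k) x` on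
`[time k, time (k+1))`, `x(time (k+1)) = R(mode k) x(time (k+1)⁻)`. -/
def flow (s : Signal S τ) (G R : α → Mat d) (t : ℝ) : Mat d :=
  NormedSpace.exp ((t - s.time (s.index t)) • G (s.mode (s.index t))) *
    s.flowAtSwitch G R (s.index t)

/-- Solutions of the impulsive switched system `E(mode k) X' = L(mode k) X` on
`[time k, time (k+1))`, `X(time (k+1)) = R(mode k) X(time (k+1)⁻)`. -/
structure IsSolution (s : Signal S τ) (E L R : α → Mat d) (X : ℝ → Fin d → ℝ) : Prop where
  deriv : ∀ k : ℕ, (k : ℕ∞) ≤ s.N → ∀ t : ℝ, s.time k ≤ t →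
    (((k + 1 : ℕ) : ℕ∞) ≤ s.N → t < s.time (k + 1)) →
    ∃ V : Fin d → ℝ, HasDerivWithinAt X V (Set.Ici (s.time k)) t ∧
      E (s.mode k) *ᵥ V = L (s.mode k) *ᵥ X t
  jump : ∀ k : ℕ, ((k + 1 : ℕ) : ℕ∞) ≤ s.N →
    ∃ x : Fin d → ℝ, Tendsto X (𝓝[<] s.time (k + 1)) (𝓝 x) ∧
      X (s.time (k + 1)) = R (s.mode k) *ᵥ x

theorem time_mono (s : Signal S τ) {j k : ℕ} (hjk : j ≤ k) (hk : (k : ℕ∞) ≤ s.N) :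
    s.time j ≤ s.time k := by
  induction k, hjk using Nat.le_induction with
  | base => exact le_rfl
  | succ k _ ih =>
    exact (ih (le_trans (by exact_mod_cast Nat.le_succ k) hk)).trans (s.time_lt k hk).le

theorem index_eq (s : Signal S τ) {k : ℕ} (hk : (k : ℕ∞) ≤ s.N) {t : ℝ} (h1 : s.time k ≤ t)
    (h2 : ((k + 1 : ℕ) : ℕ∞) ≤ s.N → t < s.time (k + 1)) : s.index t = k := by
  have hub : ∀ j ∈ {j : ℕ | (j : ℕ∞) ≤ s.N ∧ s.time j ≤ t}, j ≤ k := by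
    rintro j ⟨hj, hjt⟩
    by_contra hlt
    have hkj : k + 1 ≤ j := by omega
    have hk1 : ((k + 1 : ℕ) : ℕ∞) ≤ s.N := le_trans (by exact_mod_cast hkj) hj
    have := s.time_mono hkj hj
    have := h2 hk1
    linarith
  exact IsGreatest.csSup_eq ⟨⟨hk, h1⟩, hub⟩

theorem flow_eq (s : Signal S τ) (G R : α → Mat d) {k : ℕ} (hk : (k : ℕ∞) ≤ s.N) {t : ℝ}
    (h1 : s.time k ≤ t) (h2 : ((k + 1 : ℕ) : ℕ∞) ≤ s.N → t < s.time (k + 1)) :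
    s.flow G R t = NormedSpace.exp ((t - s.time k) • G (s.mode k)) * s.flowAtSwitch G R k := by
  simp only [flow, s.index_eq hk h1 h2]

theorem hasDerivAt_exp_mulVec (A : Mat d) (a t : ℝ) (x : Fin d → ℝ) :
    HasDerivAt (fun r : ℝ => NormedSpace.exp ((r - a) • A) *ᵥ x)
      (A *ᵥ (NormedSpace.exp ((t - a) • A) *ᵥ x)) t := by
  let _i : NormedRing (Mat d) := Matrix.linftyOpNormedRing
  let _j : NormedAlgebra ℝ (Mat d) := Matrix.linftyOpNormedAlgebra
  have h := (hasDerivAt_exp_smul_const' (𝕂 := ℝ) A (t - a)).comp_sub_const t a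
  let T : Mat d →ₗ[ℝ] (Fin d → ℝ) :=
    { toFun := fun M => M *ᵥ x
      map_add' := fun M M' => Matrix.add_mulVec M M' x
      map_smul' := fun c M => Matrix.smul_mulVec c M x }
  have h' := (LinearMap.toContinuousLinearMap T).hasFDerivAt.comp_hasDerivAt t h
  rw [Matrix.mulVec_mulVec]
  exact h'

/-- The flow maps initial conditions to solutions. -/
theorem flow_isSolution (s : Signal S τ) (E L G R : α → Mat d)
    (hG : ∀ a ∈ S, E a * G a = L a) (x : Fin d → ℝ) :
    s.IsSolution E L R (fun t => s.flow G R t *ᵥ x) ∧ s.flow G R 0 *ᵥ x = x := by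
  have hval : ∀ k : ℕ, (k : ℕ∞) ≤ s.N → s.flow G R (s.time k) = s.flowAtSwitch G R k := by
    intro k hk
    rw [s.flow_eq G R hk le_rfl (s.time_lt k)]
    simp
  refine ⟨⟨?_, ?_⟩, ?_⟩
  · intro k hk t h1 h2
    have hd := hasDerivAt_exp_mulVec (G (s.mode k)) (s.time k) t (s.flowAtSwitch G R k *ᵥ x)
    refine ⟨_, (hd.hasDerivWithinAt (s := Set.Ici (s.time k))).congr_of_eventuallyEq_of_mem
      ?_ h1, ?_⟩
    · have hev : ∀ᶠ r in 𝓝 t, ((k + 1 : ℕ) : ℕ∞) ≤ s.N → r < s.time (k + 1) := by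
        by_cases h : ((k + 1 : ℕ) : ℕ∞) ≤ s.N
        · exact (eventually_lt_nhds (h2 h)).mono fun r hr _ => hr
        · exact Eventually.of_forall fun r hr => absurd hr h
      filter_upwards [self_mem_nhdsWithin, nhdsWithin_le_nhds hev] with r hr1 hr2
      rw [s.flow_eq G R hk hr1 hr2, Matrix.mulVec_mulVec]
    · simp only [s.flow_eq G R hk h1 h2, ← hG _ (s.mode_mem k hk), Matrix.mulVec_mulVec,
        Matrix.mul_assoc]
  · intro k hk1
    have hk : (k : ℕ∞) ≤ s.N := le_trans (by exact_mod_cast Nat.le_succ k) hk1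
    have hc := (hasDerivAt_exp_mulVec (G (s.mode k)) (s.time k) (s.time (k + 1))
      (s.flowAtSwitch G R k *ᵥ x)).continuousAt.tendsto
    refine ⟨_, (hc.mono_left nhdsWithin_le_nhds).congr' ?_, ?_⟩
    · have hev := Ico_mem_nhdsLT (s.time_lt k hk1)
      filter_upwards [hev] with r hr
      rw [s.flow_eq G R hk hr.1 (fun _ => hr.2), Matrix.mulVec_mulVec]
    · simp only [hval _ hk1, flowAtSwitch, Matrix.mulVec_mulVec, Matrix.mul_assoc]
  · have h0 := hval 0 (by simp)
    rw [s.time_zero] at h0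
    rw [h0]
    simp [flowAtSwitch]

end Signal

/-- The operator norm of a matrix induced by the Euclidean norm. -/
def euclOpNorm {d : ℕ} (M : Mat d) : ℝ := ‖Matrix.toEuclideanCLM (𝕜 := ℝ) M‖

/-- The maximal Lyapunov exponent, in `[-∞, +∞]`, of the impulsive switched system with signals in
`S` of dwell time `τ`, generators `G` and jump matrices `R`; here `log 0 = -∞`. -/
def maxLyapunov {α : Type*} {d : ℕ} (S : Set α) (τ : ℝ) (G R : α → Mat d) : EReal :=
  limsup (fun t : ℝ => ⨆ s : Signal S τ,
    ENNReal.log (ENNReal.ofReal (euclOpNorm (s.flow G R t))) / (t : EReal)) atTop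

/-- The maximal Lyapunov exponent `λ(Δ_{Z,τ})`: a mode `(Z₁, Z₂)` has the dynamics `x' = Z₁ x` and
the jump matrix `Z₂`. -/
def lyapunovDelta {d : ℕ} (Z : Set (Mat d × Mat d)) (τ : ℝ) : EReal :=
  maxLyapunov Z τ Prod.fst Prod.snd

/-- The spectral abscissa: the maximal real part of the complex eigenvalues. -/
def spectralAbscissa {d : ℕ} (M : Mat d) : EReal :=
  ⨆ z ∈ spectrum ℂ (M.map (fun r : ℝ => (r : ℂ))), (z.re : EReal)

/-- The discrete-time switched system with set of modes `Y` is bounded. -/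
def DiscreteBounded {d : ℕ} (Y : Set (Mat d)) : Prop :=
  ∃ C : ℝ, 0 < C ∧ ∀ L : List (Mat d), L ≠ [] → (∀ M ∈ L, M ∈ Y) → euclOpNorm L.prod ≤ C

/-- Modes `(ℓ, P, Λ, R) ∈ {1, …, d-1} × GL(d,ℝ) × M_d(ℝ) × M_d(ℝ)`, with the product topology. -/
abbrev Mode (d : ℕ) : Type := Set.Icc 1 (d - 1) × GL (Fin d) ℝ × Mat d × Mat d

namespace Mode

variable {d : ℕ}

def ell (σ : Mode d) : ℕ := (σ.1 : ℕ)

def P (σ : Mode d) : Mat d := ((σ.2.1 : GL (Fin d) ℝ) : Mat d)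

def Lam (σ : Mode d) : Mat d := σ.2.2.1

def R (σ : Mode d) : Mat d := σ.2.2.2

end Mode

/-- `E_ℓ^ε`: diagonal, with entries `1` on the first `ℓ` lines and `ε` elsewhere. -/
def slowFast (d ℓ : ℕ) (ε : ℝ) : Mat d :=
  Matrix.diagonal fun i : Fin d => if (i : ℕ) < ℓ then 1 else ε

/-- `E_{ℓᶜ}^ε`: diagonal, with entries `ε` on the first `ℓ` lines and `1` elsewhere. -/
def slowFastCompl (d ℓ : ℕ) (ε : ℝ) : Mat d :=
  Matrix.diagonal fun i : Fin d => if (i : ℕ) < ℓ then ε else 1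

/-- The generator `(E_ℓ^ε P)⁻¹ Λ` of `E_ℓ^ε P X' = Λ X`. -/
def singGenerator {d : ℕ} (ε : ℝ) (σ : Mode d) : Mat d :=
  (slowFast d σ.ell ε * σ.P)⁻¹ * σ.Lam

theorem mul_singGenerator {d : ℕ} {ε : ℝ} (hε : 0 < ε) (σ : Mode d) :
    (slowFast d σ.ell ε * σ.P) * singGenerator ε σ = σ.Lam := by
  have hP : IsUnit σ.P.det := (Matrix.isUnit_iff_isUnit_det _).1 σ.2.1.isUnit
  have hE : IsUnit (slowFast d σ.ell ε).det := by
    rw [slowFast, Matrix.det_diagonal, isUnit_iff_ne_zero, Finset.prod_ne_zero_iff]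
    intro i _
    split_ifs
    · exact one_ne_zero
    · exact hε.ne'
  rw [singGenerator, Matrix.mul_nonsing_inv_cancel_left]
  rw [Matrix.det_mul]
  exact hE.mul hP

/-- The flow with generators `singGenerator ε` is the flow of the singularly perturbed system
`E_{ℓ_k}^ε P_k X' = Λ_k X` on `[t_k, t_{k+1})`, `X(t_k) = R_{k-1} X(t_k⁻)`. -/
theorem singFlow_isSolution {d : ℕ} {ε : ℝ} (hε : 0 < ε) {K : Set (Mode d)} {τ : ℝ}
    (s : Signal K τ) (x : Fin d → ℝ) :
    s.IsSolution (fun σ => slowFast d σ.ell ε * σ.P) Mode.Lam Mode.R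
        (fun t => s.flow (singGenerator ε) Mode.R t *ᵥ x) ∧
      s.flow (singGenerator ε) Mode.R 0 *ᵥ x = x :=
  s.flow_isSolution _ _ _ _ (fun σ _ => mul_singGenerator hε σ) x

/-- The maximal Lyapunov exponent `λ(Σ_{K,τ}^ε)` of the singularly perturbed system, `ε > 0`. -/
def lyapunovSigma {d : ℕ} (K : Set (Mode d)) (τ ε : ℝ) : EReal :=
  maxLyapunov K τ (singGenerator ε) Mode.R

/-- The matrix `P⁻¹ E_{ℓᶜ}^0 Λ`. -/
def fastGenerator {d : ℕ} (σ : Mode d) : Mat d :=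
  (σ.P)⁻¹ * slowFastCompl d σ.ell 0 * σ.Lam

/-- `Z = {(P⁻¹ E_{ℓᶜ}^0 Λ, R) | (ℓ, P, Λ, R) ∈ K}`. -/
def fastModes {d : ℕ} (K : Set (Mode d)) : Set (Mat d × Mat d) :=
  (fun σ => (fastGenerator σ, σ.R)) '' K

end SingPert

end

/-! Change time by t = ε s. Since ε (E_ℓ^ε)⁻¹ = E_{ℓᶜ}^0 + ε E_ℓ^0, the rescaled generator is
`fastGenerator` + ε `slowGenerator`. The jumps are unchanged and, without a dwell time, so is the
class of signals. Hence ελ(Σ^ε) is the exponent of an O(ε) perturbation of Δ, uniformly over the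
compact set of modes, and everything rests on how that exponent depends on the generators.

Lower bounds come from eigenvalues. A mode held forever, or a word of pieces repeated periodically,
makes the flow at least as large as the powers of an eigenvalue of its period map. Eigenvalues
persist under convergence of matrices, so an eigenvalue of modulus greater than e^{bT} for the limit
map of period T forces ελ(Σ^ε) ≥ b for small ε (`eventually_le_mul_lyapunovSigma`). Constant signals
give the spectral abscissas; these are nonnegative because E_{ℓᶜ}^0 is singular.

To reach λ(Δ) and not only single modes, a converse is needed: if all words and all single modes
have spectral radius at most e^{μT}, then all flows are O(e^{νt}) for ν > μ, when ν ≥ 0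
(`WordBound.exists_of_spectrum`). This is the Berger–Wang theorem
(`EigenvalueBound.exists_growthBound`) applied to blocks of duration at least 1. It is proved by
induction on the dimension: normalise the joint spectral radius to 1 and consider the invariant
subspace of vectors with bounded orbits. That subspace is nonzero by compactness of the sphere. If
it is proper, the family is block triangular; if it is everything, a pigeonhole argument on a
nondecaying orbit produces a product that almost fixes a vector, although its eigenvalues stay away
from 1.

For the upper bound, a bound C e^{μt} with μ ≥ 0 on all flows survives a perturbation of size δ of
the generators, with rate μ + Cδ (`WordBound.perturb`). The number of jumps is not controlled by
time, so the norm used must not increase at jumps; it therefore depends on the current mode. Bounded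
products of jumps give the a priori exponential bound that starts both arguments. -/

noncomputable section

namespace SingPert

/-! ### Growth of products and adapted norms -/

section JointSpectralRadius

variable {V : Type*} [NormedAddCommGroup V] [NormedSpace ℂ V]

/-- Products of `n` elements of `F` are `O(sⁿ)`. -/
def GrowthBound (F : Set (V →L[ℂ] V)) (s : ℝ) : Prop :=
  ∃ C : ℝ, ∀ L : List (V →L[ℂ] V), (∀ f ∈ L, f ∈ F) → ‖L.prod‖ ≤ C * s ^ L.length

/-- Eigenvalues of products of `n` elements of `F` have modulus at most `qⁿ`. -/
def EigenvalueBound (F : Set (V →L[ℂ] V)) (q : ℝ) : Prop :=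
  ∀ L : List (V →L[ℂ] V), (∀ f ∈ L, f ∈ F) → ∀ z : ℂ,
    Module.End.HasEigenvalue (L.prod : V →ₗ[ℂ] V) z → ‖z‖ ≤ q ^ L.length

/-- `N` is subadditive, equivalent to the norm, and `F` is `s`-Lipschitz with respect to it. -/
structure AdaptedNorm (F : Set (V →L[ℂ] V)) (s C : ℝ) (N : V → ℝ) : Prop where
  add_le : ∀ x y, N (x + y) ≤ N x + N y
  norm_le : ∀ x, ‖x‖ ≤ N x
  le_norm : ∀ x, N x ≤ C * ‖x‖
  map_le : ∀ f ∈ F, ∀ x, N (f x) ≤ s * N x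

/-- Take the supremum of ‖L.prod x‖ / s^n over all products of n factors, n ≥ 0. The empty product
gives the lower bound, and appending f on the right gives the Lipschitz estimate. -/
theorem GrowthBound.exists_adaptedNorm {F : Set (V →L[ℂ] V)} {s : ℝ} (hs : 0 < s)
    (h : GrowthBound F s) : ∃ C N, AdaptedNorm F s C N := by
  obtain ⟨C, hC⟩ := h
  let ι := {L : List (V →L[ℂ] V) // ∀ f ∈ L, f ∈ F}
  have : Nonempty ι := ⟨⟨[], by simp⟩⟩
  let u : V → ι → ℝ := fun x L => ‖L.1.prod x‖ / s ^ L.1.length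
  have hu : ∀ x L, u x L ≤ C * ‖x‖ := by
    intro x L
    rw [div_le_iff₀ (by positivity)]
    calc _ ≤ ‖L.1.prod‖ * ‖x‖ := L.1.prod.le_opNorm x
      _ ≤ (C * s ^ L.1.length) * ‖x‖ := by gcongr; exact hC _ L.2
      _ = _ := by ring
  have hbdd : ∀ x, BddAbove (Set.range (u x)) := fun x => ⟨C * ‖x‖, by
    rintro _ ⟨L, rfl⟩; exact hu x L⟩
  refine ⟨C, fun x => ⨆ L, u x L, ⟨fun x y => ciSup_le fun L => ?_, fun x => ?_,
    fun x => ciSup_le (hu x), fun f hf x => ciSup_le fun L => ?_⟩⟩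
  · calc u (x + y) L ≤ u x L + u y L := by
          simp only [u, map_add, ← add_div]
          gcongr
          exact norm_add_le _ _
      _ ≤ _ := add_le_add (le_ciSup (hbdd x) L) (le_ciSup (hbdd y) L)
  · have := le_ciSup (hbdd x) (⟨[], by simp⟩ : ι)
    simpa [u] using this
  · have h1 := le_ciSup (hbdd x) (⟨L.1 ++ [f], by
      intro g hg
      rcases List.mem_append.1 hg with h | h
      · exact L.2 g h
      · rw [List.mem_singleton.1 h]; exact hf⟩ : ι)
    have h2 : u (f x) L = s * (‖(L.1 ++ [f]).prod x‖ / s ^ (L.1 ++ [f]).length) := by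
      simp only [u, List.prod_append, List.prod_singleton, List.length_append,
        List.length_singleton, mul_apply_eq_comp]
      field_simp
      ring
    rw [h2]
    exact mul_le_mul_of_nonneg_left h1 hs.le

theorem AdaptedNorm.prod_le {F : Set (V →L[ℂ] V)} {s C : ℝ} {N : V → ℝ}
    (h : AdaptedNorm F s C N) (hs : 0 ≤ s) {L : List (V →L[ℂ] V)} (hL : ∀ f ∈ L, f ∈ F) (x : V) :
    N (L.prod x) ≤ s ^ L.length * N x := by
  induction L with
  | nil => simp
  | cons f L ih =>
    rw [List.prod_cons, mul_apply_eq_comp, List.length_cons, pow_succ', mul_assoc]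
    exact (h.map_le f (hL f (by simp)) _).trans
      (mul_le_mul_of_nonneg_left (ih fun g hg => hL g (by simp [hg])) hs)

theorem AdaptedNorm.growthBound {F : Set (V →L[ℂ] V)} {s C : ℝ} {N : V → ℝ}
    (h : AdaptedNorm F s C N) (hs : 0 ≤ s) : GrowthBound F s := by
  refine ⟨|C|, fun L hL => ContinuousLinearMap.opNorm_le_bound _ (by positivity) fun x => ?_⟩
  calc ‖L.prod x‖ ≤ s ^ L.length * N x := (h.norm_le _).trans (h.prod_le hs hL x)
    _ ≤ s ^ L.length * (|C| * ‖x‖) := by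
      gcongr
      exact (h.le_norm x).trans (by gcongr; exact le_abs_self C)
    _ = _ := by ring

theorem GrowthBound.mono {F : Set (V →L[ℂ] V)} {s t : ℝ} (hs : 0 ≤ s) (hst : s ≤ t)
    (h : GrowthBound F s) : GrowthBound F t := by
  obtain ⟨C, hC⟩ := h
  refine ⟨|C|, fun L hL => (hC L hL).trans ?_⟩
  calc C * s ^ L.length ≤ |C| * s ^ L.length := by gcongr; exact le_abs_self C
    _ ≤ _ := by gcongr

theorem GrowthBound.of_norm_le {F : Set (V →L[ℂ] V)} {B : ℝ} (hB : ∀ f ∈ F, ‖f‖ ≤ B) :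
    GrowthBound F (max B 0) := by
  refine ⟨1, fun L hL => ?_⟩
  rw [one_mul]
  induction L with
  | nil =>
    rw [List.prod_nil, List.length_nil, pow_zero]
    exact (ContinuousLinearMap.norm_id_le : ‖ContinuousLinearMap.id ℂ V‖ ≤ 1)
  | cons f L ih =>
    rw [List.prod_cons, List.length_cons, pow_succ']
    refine (norm_mul_le _ _).trans ?_
    gcongr
    · exact (hB f (hL f (by simp))).trans (le_max_left _ _)
    · exact ih fun g hg => hL g (by simp [hg])

/-- If products of a fixed length are contractions of an equivalent norm, then products decay
exponentially. -/
theorem AdaptedNorm.growthBound_of_contraction {F : Set (V →L[ℂ] V)} {C : ℝ} {N : V → ℝ}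
    (h : AdaptedNorm F 1 C N) {n : ℕ} (hn : 0 < n) {θ : ℝ} (hθ0 : 0 < θ) (hθ : θ < 1)
    (hc : ∀ L : List (V →L[ℂ] V), (∀ f ∈ L, f ∈ F) → L.length = n → ∀ x,
      N (L.prod x) ≤ θ * N x) : ∃ r, 0 ≤ r ∧ r < 1 ∧ GrowthBound F r := by
  have key : ∀ k : ℕ, ∀ L : List (V →L[ℂ] V), (∀ f ∈ L, f ∈ F) → k * n ≤ L.length → ∀ x,
      N (L.prod x) ≤ θ ^ k * N x := by
    intro k
    induction k with
    | zero =>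
      intro L hL _ x
      simpa using h.prod_le zero_le_one hL x
    | succ k ih =>
      intro L hL hlen x
      rw [← List.take_append_drop n L, List.prod_append, mul_apply_eq_comp]
      have hlen' : k * n + n ≤ L.length := by linarith [Nat.succ_mul k n]
      have h1 := hc (L.take n) (fun f hf => hL f (List.mem_of_mem_take hf))
        (by rw [List.length_take]; omega) ((L.drop n).prod x)
      have h2 := ih (L.drop n) (fun f hf => hL f (List.mem_of_mem_drop hf))
        (by rw [List.length_drop]; omega) x
      calc _ ≤ _ := h1
        _ ≤ θ * (θ ^ k * N x) := by gcongr
        _ = _ := by ring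
  set r : ℝ := θ ^ ((1 : ℝ) / n) with hr
  have hr0 : 0 < r := Real.rpow_pos_of_pos hθ0 _
  have hn' : (0 : ℝ) < n := by exact_mod_cast hn
  have hrn : r ^ n = θ := by
    rw [hr, ← Real.rpow_natCast, ← Real.rpow_mul hθ0.le, one_div_mul_cancel hn'.ne', Real.rpow_one]
  have hr1 : r < 1 := Real.rpow_lt_one hθ0.le hθ (by positivity)
  -- With r^n = θ, the factor 1/θ pays for the incomplete last block of fewer than n factors.
  refine ⟨r, hr0.le, hr1, |C| / θ, fun L hL =>
    ContinuousLinearMap.opNorm_le_bound _ (by positivity) fun x => ?_⟩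
  have hdiv := Nat.div_add_mod L.length n
  have hmod := Nat.mod_lt L.length hn
  have hθk : θ ^ (L.length / n) ≤ r ^ L.length / θ := by
    rw [le_div_iff₀ hθ0, ← hrn, ← pow_mul, ← pow_add]
    exact pow_le_pow_of_le_one hr0.le hr1.le (by omega)
  calc ‖L.prod x‖ ≤ θ ^ (L.length / n) * N x :=
        (h.norm_le _).trans (key _ L hL (Nat.div_mul_le_self _ _) x)
    _ ≤ (r ^ L.length / θ) * (|C| * ‖x‖) := by
        refine mul_le_mul hθk ((h.le_norm x).trans ?_) ((norm_nonneg x).trans (h.norm_le x))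
          (by positivity)
        gcongr
        exact le_abs_self C
    _ = _ := by ring

end JointSpectralRadius

/-! ### Eigenvalues, determinants and semiconjugacy -/

section Spectrum

variable {V : Type*} [AddCommGroup V] [Module ℂ V]

/-- det(w − f) is the product of w − z over the eigenvalues z with multiplicity. This turns a
spectral gap into a condition that is closed in f. -/
theorem pow_le_norm_det_of_le_dist [FiniteDimensional ℂ V] {f : V →ₗ[ℂ] V} {w : ℂ} {ρ : ℝ} (hρ : 0 ≤ ρ)
    (h : ∀ z, Module.End.HasEigenvalue f z → ρ ≤ ‖w - z‖) :
    ρ ^ Module.finrank ℂ V ≤ ‖LinearMap.det (algebraMap ℂ (V →ₗ[ℂ] V) w - f)‖ := by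
  rw [← LinearMap.eval_charpoly,
    (IsAlgClosed.splits f.charpoly).eval_eq_prod_roots_of_monic f.charpoly_monic]
  have hcard : Multiset.card f.charpoly.roots = Module.finrank ℂ V := by
    rw [← LinearMap.charpoly_natDegree f]
    exact (Polynomial.splits_iff_card_roots.1 (IsAlgClosed.splits f.charpoly))
  rw [← hcard]
  have hr : ∀ z ∈ f.charpoly.roots, ρ ≤ ‖w - z‖ := fun z hz => h z
    ((Module.End.hasEigenvalue_iff_isRoot_charpoly f z).2 (Polynomial.isRoot_of_mem_roots hz))
  generalize f.charpoly.roots = s at hr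
  induction s using Multiset.induction with
  | empty => simp
  | cons a s ih =>
    rw [Multiset.card_cons, Multiset.map_cons, Multiset.prod_cons, norm_mul, pow_succ']
    exact mul_le_mul (hr a (by simp)) (ih fun z hz => hr z (by simp [hz])) (by positivity)
      (norm_nonneg _)

theorem hasEigenvalue_of_injective_semiconj {W : Type*} [AddCommGroup W] [Module ℂ W]
    {g : W →ₗ[ℂ] W} {f : V →ₗ[ℂ] V} {i : W →ₗ[ℂ] V} (hi : Function.Injective i)
    (h : ∀ x, f (i x) = i (g x)) {z : ℂ} (hz : Module.End.HasEigenvalue g z) :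
    Module.End.HasEigenvalue f z := by
  obtain ⟨x, hx⟩ := hz.exists_hasEigenvector
  refine Module.End.hasEigenvalue_of_hasEigenvector (x := i x) ⟨?_, ?_⟩
  · rw [Module.End.mem_eigenspace_iff, h, hx.apply_eq_smul, map_smul]
  · rw [Ne, map_eq_zero_iff i hi]
    exact hx.2

theorem hasEigenvalue_iff_not_surjective [FiniteDimensional ℂ V] {f : V →ₗ[ℂ] V} {z : ℂ} :
    Module.End.HasEigenvalue f z ↔
      ¬ Function.Surjective (f - algebraMap ℂ (V →ₗ[ℂ] V) z : V →ₗ[ℂ] V) := by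
  rw [← LinearMap.injective_iff_surjective, ← LinearMap.ker_eq_bot, Module.End.hasEigenvalue_iff,
    Module.End.eigenspace_def, Algebra.algebraMap_eq_smul_one]

theorem hasEigenvalue_of_surjective_semiconj [FiniteDimensional ℂ V] {W : Type*} [AddCommGroup W] [Module ℂ W]
    [FiniteDimensional ℂ W]
    {g : W →ₗ[ℂ] W} {f : V →ₗ[ℂ] V} {p : V →ₗ[ℂ] W} (hp : Function.Surjective p)
    (h : ∀ x, p (f x) = g (p x)) {z : ℂ} (hz : Module.End.HasEigenvalue g z) :
    Module.End.HasEigenvalue f z := by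
  rw [hasEigenvalue_iff_not_surjective] at hz ⊢
  refine fun hs => hz fun y => ?_
  obtain ⟨x, rfl⟩ := hp y
  obtain ⟨v, rfl⟩ := hs x
  exact ⟨p v, by simp [h]⟩

end Spectrum

/-! ### Bounded products and unbounded orbits -/

section JointSpectralRadius

/-- Pigeonhole on a finite cover of the unit ball by balls of radius δ/2. -/
theorem exists_lt_dist_lt_of_norm_le_one (V : Type*) [NormedAddCommGroup V] [ProperSpace V]
    {δ : ℝ} (hδ : 0 < δ) : ∃ n : ℕ, 0 < n ∧ ∀ y : ℕ → V, (∀ j ≤ n, ‖y j‖ ≤ 1) →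
      ∃ i j, i < j ∧ j ≤ n ∧ ‖y j - y i‖ < δ := by
  obtain ⟨t, ht, hcov⟩ := Metric.totallyBounded_iff.1
    (isCompact_closedBall (0 : V) 1).totallyBounded (δ / 2) (by positivity)
  refine ⟨ht.toFinset.card + 1, by omega, fun y hy => ?_⟩
  have hc : ∀ j ≤ ht.toFinset.card + 1, ∃ c ∈ t, dist (y j) c < δ / 2 := by
    intro j hj
    have := hcov (show y j ∈ Metric.closedBall (0 : V) 1 by simpa using hy j hj)
    simpa using this
  choose! c hct hcd using hc
  obtain ⟨i, hi, j, hj, hij, hcij⟩ := Finset.exists_ne_map_eq_of_card_lt_of_maps_to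
    (s := Finset.range (ht.toFinset.card + 2)) (t := ht.toFinset) (f := c) (by simp)
    (fun j hj => by
      have := Finset.mem_range.1 hj
      simpa using hct j (by omega))
  have hi := Finset.mem_range.1 hi
  have hj := Finset.mem_range.1 hj
  have hd : dist (y i) (y j) < δ := by
    have h1 := hcd i (by omega)
    have h2 := hcd j (by omega)
    rw [hcij] at h1
    have := dist_triangle_right (y i) (y j) (c j)
    linarith
  rcases lt_or_gt_of_ne hij with h | h
  · exact ⟨i, j, h, by omega, by rwa [← dist_eq_norm, dist_comm]⟩
  · exact ⟨j, i, h, by omega, by rwa [← dist_eq_norm]⟩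

variable {V : Type*} [NormedAddCommGroup V] [NormedSpace ℂ V] [FiniteDimensional ℂ V]

/-- A family whose products are bounded and have small eigenvalues decays exponentially. -/
theorem AdaptedNorm.exists_growthBound_lt_one {F : Set (V →L[ℂ] V)} {C : ℝ} {N : V → ℝ}
    (h : AdaptedNorm F 1 C N) {q : ℝ} (hq0 : 0 ≤ q) (hq : q < 1) (hF : EigenvalueBound F q) :
    ∃ r, 0 ≤ r ∧ r < 1 ∧ GrowthBound F r := by
  by_contra hcon
  -- Without decay, no length n makes all products contract `N` by 1/2, so there are arbitrarily
  -- long orbits along which `N` loses at most a factor 2.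
  have hlong : ∀ n : ℕ, 0 < n → ∃ L : List (V →L[ℂ] V), (∀ f ∈ L, f ∈ F) ∧ L.length = n ∧
      ∃ x, 1 / 2 * N x < N (L.prod x) := by
    intro n hn
    by_contra hno
    push Not at hno
    exact hcon (h.growthBound_of_contraction hn (θ := 1 / 2) (by norm_num) (by norm_num) hno)
  have : ProperSpace V := FiniteDimensional.proper ℂ V
  have : ProperSpace (V →L[ℂ] V) := FiniteDimensional.proper ℂ _
  set C' : ℝ := |C| + 1 with hC'
  have hC'0 : 0 < C' := by positivity
  have hCC' : C ≤ C' := (le_abs_self C).trans (by linarith)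
  have hNC : ∀ x, N x ≤ C' * ‖x‖ := fun x => (h.le_norm x).trans (by gcongr)
  have hN0 : ∀ x, 0 ≤ N x := fun x => (norm_nonneg x).trans (h.norm_le x)
  set d := Module.finrank ℂ V
  -- `Q` holds the pairs (product, orbit point) that can occur. On it the determinant keeps 1 − M
  -- invertible and the vector is nonzero, so by compactness ‖My − y‖ has a positive lower bound δ.
  -- Two orbit points closer than δ will contradict this.
  let Q : Set ((V →L[ℂ] V) × V) := {p | p ∈ Metric.closedBall 0 C' ×ˢ Metric.closedBall 0 1 ∧
    (1 - q) ^ d ≤ ‖(1 - p.1).det‖ ∧ 1 / (2 * C') ≤ ‖p.2‖}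
  have hQ : IsCompact Q := by
    refine ((isCompact_closedBall _ _).prod (isCompact_closedBall _ _)).inter_right
      (IsClosed.inter (isClosed_le (f := fun _ => (1 - q) ^ d)
        (g := fun p : (V →L[ℂ] V) × V => ‖(1 - p.1).det‖) continuous_const ?_)
        (isClosed_le (f := fun _ => 1 / (2 * C')) (g := fun p : (V →L[ℂ] V) × V => ‖p.2‖)
          continuous_const ?_))
    · exact (ContinuousLinearMap.continuous_det.comp (continuous_const.sub continuous_fst)).norm
    · exact continuous_snd.norm
  obtain ⟨δ, hδ, hδQ⟩ := hQ.exists_forall_le' (f := fun p => ‖p.1 p.2 - p.2‖) (a := 0)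
    (by fun_prop) (by
      rintro ⟨M, y⟩ ⟨-, hdet, hy⟩
      simp only at hdet hy
      rw [norm_pos_iff, sub_ne_zero]
      intro hMy
      have h0 : (1 - M).det = 0 := by
        by_contra hne
        have : y = 0 := (LinearEquiv.map_eq_zero_iff (LinearMap.equivOfDetNeZero
          ((1 - M : V →L[ℂ] V) : V →ₗ[ℂ] V) hne)).1 (by
            change (1 - M) y = 0
            simp [hMy])
        rw [this, norm_zero] at hy
        have : 0 < 1 / (2 * C') := by positivity
        linarith
      rw [h0, norm_zero] at hdet
      have : 0 < (1 - q) ^ d := pow_pos (by linarith) _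
      linarith)
  obtain ⟨n, hn, hpig⟩ := exists_lt_dist_lt_of_norm_le_one V hδ
  obtain ⟨L, hL, hLn, x, hx⟩ := hlong n hn
  have hNx : 0 < N x := by
    have h1 := h.prod_le zero_le_one hL x
    rw [one_pow, one_mul] at h1
    by_contra hle
    have := hN0 (L.prod x)
    have := hN0 x
    linarith
  -- The orbit of `x`: the rightmost factors act first, so `u j` is the point after j steps.
  let u : ℕ → V := fun j => (L.drop (n - j)).prod x
  have hdrop : ∀ m, ∀ f ∈ L.drop m, f ∈ F := fun m f hf => hL f (List.mem_of_mem_drop hf)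
  have hu1 : ∀ j, N (u j) ≤ N x := fun j => by
    simpa using h.prod_le zero_le_one (hdrop (n - j)) x
  have hu2 : ∀ j, 1 / 2 * N x < N (u j) := fun j => by
    refine hx.trans_le ?_
    rw [← List.take_append_drop (n - j) L, List.prod_append, mul_apply_eq_comp]
    simpa [u] using h.prod_le zero_le_one
      (fun f hf => hL f (List.mem_of_mem_take hf) : ∀ f ∈ L.take (n - j), f ∈ F) (u j)
  have hnorm : ∀ v : V, ‖((N x)⁻¹ : ℂ) • v‖ = ‖v‖ / N x := fun v => by
    rw [norm_smul, norm_inv, Complex.norm_real, Real.norm_of_nonneg hNx.le, inv_mul_eq_div]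
  obtain ⟨i, j, hij, hjn, hd⟩ := hpig (fun j => ((N x)⁻¹ : ℂ) • u j) (fun j _ => by
    rw [hnorm, div_le_one hNx]
    exact (h.norm_le _).trans (hu1 j))
  set S := (L.drop (n - j)).take (j - i)
  have hS : ∀ f ∈ S, f ∈ F := fun f hf => hdrop _ f (List.mem_of_mem_take hf)
  have hSlen : S.length = j - i := by
    simp only [S, List.length_take, List.length_drop]
    omega
  have hSu : S.prod (u i) = u j := by
    have : L.drop (n - j) = S ++ L.drop (n - i) := by
      rw [← List.take_append_drop (j - i) (L.drop (n - j)), List.drop_drop]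
      congr 2
      omega
    simp only [u]
    rw [this, List.prod_append, mul_apply_eq_comp]
  have := hδQ (S.prod, ((N x)⁻¹ : ℂ) • u i) ⟨⟨?_, ?_⟩, ?_, ?_⟩
  · simp only [map_smul, hSu] at this
    linarith
  · rw [mem_closedBall_zero_iff]
    refine ContinuousLinearMap.opNorm_le_bound _ hC'0.le fun y => (h.norm_le _).trans ?_
    have := h.prod_le zero_le_one hS y
    rw [one_pow, one_mul] at this
    exact this.trans (hNC y)
  · rw [mem_closedBall_zero_iff, hnorm, div_le_one hNx]
    exact (h.norm_le _).trans (hu1 i)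
  · have := pow_le_norm_det_of_le_dist (f := (S.prod : V →ₗ[ℂ] V)) (w := 1) (ρ := 1 - q)
      (by linarith) (fun z hz => by
        have h1 := hF S hS z hz
        have h2 : q ^ S.length ≤ q := pow_le_of_le_one hq0 hq.le (by omega)
        have h3 := norm_sub_norm_le (1 : ℂ) z
        rw [norm_one] at h3
        linarith)
    rw [map_one] at this
    exact this
  · rw [hnorm, div_le_div_iff₀ (by positivity) hNx]
    have := (hu2 i).trans_le (hNC (u i))
    linarith

/-- If every nonzero vector has an unbounded orbit, products grow exponentially. -/
theorem exists_not_growthBound [Nontrivial V] {F : Set (V →L[ℂ] V)}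
    (h : ∀ x : V, x ≠ 0 → ∀ C : ℝ, ∃ L : List (V →L[ℂ] V), (∀ f ∈ L, f ∈ F) ∧
      C < ‖L.prod x‖) : ∃ t, 1 < t ∧ ¬ GrowthBound F t := by
  have : ProperSpace V := FiniteDimensional.proper ℂ V
  -- Being more than doubled by a given product is an open condition, so compactness of the sphere
  -- bounds the lengths needed.
  obtain ⟨n, hn⟩ : ∃ n : ℕ, ∀ x ∈ Metric.sphere (0 : V) 1, ∃ L : List (V →L[ℂ] V),
      (∀ f ∈ L, f ∈ F) ∧ L.length ≤ n ∧ 2 < ‖L.prod x‖ := by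
    refine (isCompact_sphere (0 : V) 1).induction_on (p := fun S => ∃ n : ℕ, ∀ x ∈ S,
      ∃ L : List (V →L[ℂ] V), (∀ f ∈ L, f ∈ F) ∧ L.length ≤ n ∧ 2 < ‖L.prod x‖)
      ⟨0, by simp⟩ ?_ ?_ ?_
    · rintro S T hST ⟨n, hn⟩
      exact ⟨n, fun x hx => hn x (hST hx)⟩
    · rintro S T ⟨n, hn⟩ ⟨m, hm⟩
      refine ⟨max n m, fun x hx => ?_⟩
      rcases hx with hx | hx
      · obtain ⟨L, h1, h2, h3⟩ := hn x hx
        exact ⟨L, h1, h2.trans (le_max_left _ _), h3⟩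
      · obtain ⟨L, h1, h2, h3⟩ := hm x hx
        exact ⟨L, h1, h2.trans (le_max_right _ _), h3⟩
    · intro x hx
      obtain ⟨L, hL, hLx⟩ := h x (ne_zero_of_mem_unit_sphere ⟨x, hx⟩) 2
      refine ⟨{y | 2 < ‖L.prod y‖}, mem_nhdsWithin_of_mem_nhds ?_, L.length,
        fun y hy => ⟨L, hL, le_rfl, hy⟩⟩
      exact (isOpen_lt continuous_const (by fun_prop)).mem_nhds hLx
  have hscale : ∀ x : V, x ≠ 0 → ∃ L : List (V →L[ℂ] V),
      (∀ f ∈ L, f ∈ F) ∧ L.length ≤ n ∧ 2 * ‖x‖ ≤ ‖L.prod x‖ := by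
    intro x hx
    have hx' : 0 < ‖x‖ := norm_pos_iff.2 hx
    have hnorm : ∀ v : V, ‖((‖x‖)⁻¹ : ℂ) • v‖ = ‖v‖ / ‖x‖ := fun v => by
      rw [norm_smul, norm_inv, Complex.norm_real, norm_norm, inv_mul_eq_div]
    obtain ⟨L, h1, h2, h3⟩ := hn (((‖x‖)⁻¹ : ℂ) • x) (by
      rw [mem_sphere_zero_iff_norm, hnorm, div_self hx'.ne'])
    refine ⟨L, h1, h2, ?_⟩
    rw [map_smul, hnorm, lt_div_iff₀ hx'] at h3
    exact h3.le
  obtain ⟨x, hx⟩ := exists_ne (0 : V)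
  have hiter : ∀ k : ℕ, ∃ L : List (V →L[ℂ] V), (∀ f ∈ L, f ∈ F) ∧ L.length ≤ k * n ∧
      2 ^ k * ‖x‖ ≤ ‖L.prod x‖ := by
    intro k
    induction k with
    | zero => exact ⟨[], by simp, by simp, by simp⟩
    | succ k ih =>
      obtain ⟨L, h1, h2, h3⟩ := ih
      have hne : L.prod x ≠ 0 := norm_pos_iff.1 (lt_of_lt_of_le
        (mul_pos (by positivity) (norm_pos_iff.2 hx)) h3)
      obtain ⟨L', h1', h2', h3'⟩ := hscale _ hne
      refine ⟨L' ++ L, ?_, ?_, ?_⟩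
      · intro f hf
        rcases List.mem_append.1 hf with hf | hf
        exacts [h1' f hf, h1 f hf]
      · rw [List.length_append, Nat.succ_mul]
        omega
      · rw [List.prod_append, mul_apply_eq_comp, pow_succ']
        linarith
  -- Growth at rate `t` allows only a factor (3/2)^k over k n steps, while some orbit grows by 2^k.
  -- The exponent uses n + 1 because n may be 0.
  set t : ℝ := (3 / 2 : ℝ) ^ ((1 : ℝ) / (n + 1 : ℕ)) with ht
  have ht1 : 1 < t := Real.one_lt_rpow (by norm_num) (by positivity)
  have htn : t ^ (n + 1) = 3 / 2 := by
    rw [ht, ← Real.rpow_natCast, ← Real.rpow_mul (by norm_num), one_div_mul_cancel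
      (by positivity), Real.rpow_one]
  refine ⟨t, ht1, fun ⟨C, hC⟩ => ?_⟩
  have hbound : ∀ k : ℕ, (4 / 3 : ℝ) ^ k ≤ |C| := by
    intro k
    obtain ⟨L, h1, h2, h3⟩ := hiter k
    have h4 : ‖L.prod x‖ ≤ |C| * (3 / 2) ^ k * ‖x‖ := by
      refine (L.prod.le_opNorm x).trans ?_
      gcongr
      refine (hC L h1).trans (mul_le_mul (le_abs_self C) ?_ (by positivity) (abs_nonneg C))
      rw [← htn, ← pow_mul]
      exact pow_le_pow_right₀ ht1.le (h2.trans (by nlinarith))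
    have h5 : (2 : ℝ) ^ k ≤ |C| * (3 / 2) ^ k :=
      le_of_mul_le_mul_right (h3.trans h4) (norm_pos_iff.2 hx)
    have h6 : (2 : ℝ) ^ k = (4 / 3) ^ k * (3 / 2) ^ k := by rw [← mul_pow]; norm_num
    rw [h6] at h5
    exact le_of_mul_le_mul_right h5 (by positivity)
  obtain ⟨k, hk⟩ := pow_unbounded_of_one_lt |C| (by norm_num : (1 : ℝ) < 4 / 3)
  exact absurd (hbound k) (not_le.2 hk)

end JointSpectralRadius

/-! ### Reduction to invariant subspaces and the Berger–Wang theorem -/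

section JointSpectralRadius

universe u

section Smul

variable {V : Type*} [NormedAddCommGroup V] [NormedSpace ℂ V]

theorem exists_prod_eq_pow_smul {F : Set (V →L[ℂ] V)} {c : ℂ} {L : List (V →L[ℂ] V)}
    (hL : ∀ g ∈ L, g ∈ (fun f => c • f) '' F) :
    ∃ L' : List (V →L[ℂ] V), (∀ f ∈ L', f ∈ F) ∧ L'.length = L.length ∧
      L.prod = c ^ L.length • L'.prod := by
  induction L with
  | nil => exact ⟨[], by simp, rfl, by simp⟩
  | cons g L ih =>
    obtain ⟨L', h1, h2, h3⟩ := ih fun f hf => hL f (by simp [hf])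
    obtain ⟨f, hf, rfl⟩ := hL g (by simp)
    refine ⟨f :: L', ?_, by simp [h2], ?_⟩
    · intro k hk
      rcases List.mem_cons.1 hk with rfl | hk
      exacts [hf, h1 k hk]
    · rw [List.prod_cons, h3, List.prod_cons, List.length_cons, pow_succ', smul_mul_smul_comm]

theorem GrowthBound.image_smul {F : Set (V →L[ℂ] V)} {s : ℝ} (h : GrowthBound F s) (c : ℂ) :
    GrowthBound ((fun f => c • f) '' F) (‖c‖ * s) := by
  obtain ⟨C, hC⟩ := h
  refine ⟨C, fun L hL => ?_⟩
  obtain ⟨L', h1, h2, h3⟩ := exists_prod_eq_pow_smul hL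
  rw [h3, norm_smul, norm_pow, mul_pow, ← h2]
  calc _ ≤ ‖c‖ ^ L'.length * (C * s ^ L'.length) := by gcongr; exact hC L' h1
    _ = _ := by ring

theorem EigenvalueBound.image_smul {F : Set (V →L[ℂ] V)} {q : ℝ} (h : EigenvalueBound F q)
    {c : ℂ} (hc : c ≠ 0) : EigenvalueBound ((fun f => c • f) '' F) (‖c‖ * q) := by
  intro L hL z hz
  obtain ⟨L', h1, h2, h3⟩ := exists_prod_eq_pow_smul hL
  have hc' : c ^ L.length ≠ 0 := pow_ne_zero _ hc
  obtain ⟨x, hx⟩ := hz.exists_hasEigenvector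
  have hz' : Module.End.HasEigenvalue (L'.prod : V →ₗ[ℂ] V) ((c ^ L.length)⁻¹ * z) := by
    refine Module.End.hasEigenvalue_of_hasEigenvector (x := x) ⟨?_, hx.2⟩
    rw [Module.End.mem_eigenspace_iff, mul_smul, ← hx.apply_eq_smul, h3]
    simp [smul_smul, inv_mul_cancel₀ hc']
  have := h L' h1 _ hz'
  rw [norm_mul, norm_inv, norm_pow, h2, inv_mul_le_iff₀ (by positivity)] at this
  rwa [mul_pow]

theorem GrowthBound.of_image_smul {F : Set (V →L[ℂ] V)} {s : ℝ} {c : ℂ} (hc : c ≠ 0)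
    (h : GrowthBound ((fun f => c • f) '' F) s) : GrowthBound F (‖c‖⁻¹ * s) := by
  have := h.image_smul c⁻¹
  rw [Set.image_image, norm_inv] at this
  simpa [smul_smul, inv_mul_cancel₀ hc] using this

end Smul

section Reducible

variable {V : Type u} [NormedAddCommGroup V] [NormedSpace ℂ V]

/-- The restrictions of the elements of `F` to an invariant subspace. -/
def restrictFamily (F : Set (V →L[ℂ] V)) (K : Submodule ℂ V) : Set (K →L[ℂ] K) :=
  {g | ∃ f ∈ F, ∀ x : K, (g x : V) = f x}

/-- The compressions of the elements of `F` along the projection `p`. -/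
def compressFamily (F : Set (V →L[ℂ] V)) {K : Submodule ℂ V} (p : V →L[ℂ] K) :
    Set (K →L[ℂ] K) :=
  {g | ∃ f ∈ F, ∀ x : K, g x = p (f x)}

theorem EigenvalueBound.restrict {F : Set (V →L[ℂ] V)} {q : ℝ} (h : EigenvalueBound F q)
    (K : Submodule ℂ V) : EigenvalueBound (restrictFamily F K) q := by
  intro L hL z hz
  obtain ⟨L', h1, h2, h3⟩ : ∃ L' : List (V →L[ℂ] V), (∀ f ∈ L', f ∈ F) ∧
      L'.length = L.length ∧ ∀ x : K, L'.prod x = (L.prod x : V) := by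
    clear hz
    induction L with
    | nil => exact ⟨[], by simp, rfl, by simp⟩
    | cons g L ih =>
      obtain ⟨L', h1, h2, h3⟩ := ih fun f hf => hL f (by simp [hf])
      obtain ⟨f, hf, hfg⟩ := hL g (by simp)
      refine ⟨f :: L', ?_, by simp [h2], fun x => ?_⟩
      · intro k hk
        rcases List.mem_cons.1 hk with rfl | hk
        exacts [hf, h1 k hk]
      · rw [List.prod_cons, mul_apply_eq_comp, h3, List.prod_cons, mul_apply_eq_comp, hfg]
  rw [← h2]
  exact h L' h1 z (hasEigenvalue_of_injective_semiconj (i := K.subtype) K.injective_subtype h3 hz)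

theorem EigenvalueBound.compress [FiniteDimensional ℂ V] {F : Set (V →L[ℂ] V)} {q : ℝ}
    (h : EigenvalueBound F q) {K : Submodule ℂ V} {p : V →L[ℂ] K}
    (hp : ∀ x : K, p x = x) (hF : ∀ f ∈ F, ∀ x, p (f x) = p (f (p x))) :
    EigenvalueBound (compressFamily F p) q := by
  intro L hL z hz
  obtain ⟨L', h1, h2, h3⟩ : ∃ L' : List (V →L[ℂ] V), (∀ f ∈ L', f ∈ F) ∧
      L'.length = L.length ∧ ∀ x : V, p (L'.prod x) = L.prod (p x) := by
    clear hz
    induction L with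
    | nil => exact ⟨[], by simp, rfl, by simp⟩
    | cons g L ih =>
      obtain ⟨L', h1, h2, h3⟩ := ih fun f hf => hL f (by simp [hf])
      obtain ⟨f, hf, hfg⟩ := hL g (by simp)
      refine ⟨f :: L', ?_, by simp [h2], fun x => ?_⟩
      · intro k hk
        rcases List.mem_cons.1 hk with rfl | hk
        exacts [hf, h1 k hk]
      · rw [List.prod_cons, mul_apply_eq_comp, hF f hf, h3, List.prod_cons, mul_apply_eq_comp,
          hfg]
  rw [← h2]
  exact h L' h1 z (hasEigenvalue_of_surjective_semiconj (p := (p : V →ₗ[ℂ] K))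
    (fun x => ⟨x, hp x⟩) h3 hz)

/-- Block triangular families decay exponentially if their diagonal blocks do. -/
theorem exists_growthBound_of_blocks {F : Set (V →L[ℂ] V)} {B : ℝ} (hB : ∀ f ∈ F, ‖f‖ ≤ B)
    {K K' : Submodule ℂ V} {k : V →L[ℂ] K} {p : V →L[ℂ] K'}
    (hkp : ∀ x, (k x : V) + p x = x) (hk : ∀ x : K, k x = x) (hp : ∀ x : K, p x = 0)
    (hF : ∀ f ∈ F, ∀ x ∈ K, f x ∈ K) {r₁ r₂ : ℝ} (hr₁ : 0 ≤ r₁) (hr₁' : r₁ < 1)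
    (hr₂ : 0 ≤ r₂) (hr₂' : r₂ < 1)
    (h₁ : GrowthBound (restrictFamily F K) r₁) (h₂ : GrowthBound (compressFamily F p) r₂) :
    ∃ r, 0 ≤ r ∧ r < 1 ∧ GrowthBound F r := by
  set r : ℝ := (max r₁ r₂ + 1) / 2 with hr
  have hr0 : 0 < r := by have := le_max_left r₁ r₂; linarith
  have hr1 : r < 1 := by have := max_lt hr₁' hr₂'; linarith
  have hr₁r : r₁ ≤ r := by have := max_lt hr₁' hr₂'; have := le_max_left r₁ r₂; linarith
  have hr₂r : r₂ ≤ r := by have := max_lt hr₁' hr₂'; have := le_max_right r₁ r₂; linarith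
  obtain ⟨C₁, N₁, hN₁⟩ := (h₁.mono hr₁ hr₁r).exists_adaptedNorm hr0
  obtain ⟨C₂, N₂, hN₂⟩ := (h₂.mono hr₂ hr₂r).exists_adaptedNorm hr0
  set c : ℝ := |C₁| * (‖k‖ * |B|)
  have hc : 0 ≤ c := by positivity
  set ρ : ℝ := (r + 1) / 2
  have hρr : 0 < ρ - r := by simp only [ρ]; linarith
  -- The adapted norm will be N₁(k x) + M N₂(p x). The off-diagonal block costs at most c N₂(p x),
  -- and M is large enough to absorb this in the gap between r and ρ.
  set M : ℝ := 1 + c / (ρ - r)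
  have hM1 : 1 ≤ M := by simp only [M]; have := div_nonneg hc hρr.le; linarith
  have hMc : c + M * r ≤ M * ρ := by
    have : M * (ρ - r) = (ρ - r) + c := by simp only [M]; field_simp
    nlinarith
  have hρ0 : 0 ≤ ρ := by simp only [ρ]; linarith
  have hN : AdaptedNorm F ρ (|C₁| * ‖k‖ + M * (|C₂| * ‖p‖))
      (fun x => N₁ (k x) + M * N₂ (p x)) := by
    refine ⟨fun x y => ?_, fun x => ?_, fun x => ?_, fun f hf x => ?_⟩
    · have h1 := hN₁.add_le (k x) (k y)
      have h2 := mul_le_mul_of_nonneg_left (hN₂.add_le (p x) (p y)) (by linarith : 0 ≤ M)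
      simp only [map_add]
      linarith
    · have h1 := hN₁.norm_le (k x)
      have h2 := hN₂.norm_le (p x)
      have h3 := norm_add_le (k x : V) (p x)
      rw [hkp] at h3
      simp only [Submodule.coe_norm] at h1 h2
      have h4 := mul_le_mul_of_nonneg_right hM1 ((norm_nonneg (p x : V)).trans h2)
      linarith
    · have h1 : N₁ (k x) ≤ |C₁| * (‖k‖ * ‖x‖) := (hN₁.le_norm _).trans
        (mul_le_mul (le_abs_self _) (k.le_opNorm x) (norm_nonneg _) (abs_nonneg _))
      have h2 : N₂ (p x) ≤ |C₂| * (‖p‖ * ‖x‖) := (hN₂.le_norm _).trans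
        (mul_le_mul (le_abs_self _) (p.le_opNorm x) (norm_nonneg _) (abs_nonneg _))
      have h3 := mul_le_mul_of_nonneg_left h2 (by linarith : 0 ≤ M)
      linarith
    · let g₁ : K →L[ℂ] K := k.comp (f.comp K.subtypeL)
      let g₂ : K' →L[ℂ] K' := p.comp (f.comp K'.subtypeL)
      have hg₁ : g₁ ∈ restrictFamily F K := ⟨f, hf, fun y => by
        have := hk ⟨f y, hF f hf y y.2⟩
        simpa [g₁] using congrArg Subtype.val this⟩
      have hg₂ : g₂ ∈ compressFamily F p := ⟨f, hf, fun y => rfl⟩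
      have e1 : k (f x) = g₁ (k x) + k (f (p x)) := by
        simp only [g₁, ContinuousLinearMap.comp_apply, Submodule.subtypeL_apply]
        rw [← map_add, ← map_add, hkp]
      have e2 : p (f x) = g₂ (p x) := by
        have h0 := hp ⟨f (k x), hF f hf _ (k x).2⟩
        simp only at h0
        simp only [g₂, ContinuousLinearMap.comp_apply, Submodule.subtypeL_apply]
        conv_lhs => rw [← hkp x, map_add, map_add, h0, zero_add]
      have i1 := hN₁.map_le g₁ hg₁ (k x)
      have i2 := hN₂.map_le g₂ hg₂ (p x)
      have i3 := hN₁.add_le (g₁ (k x)) (k (f (p x)))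
      have i4 : N₁ (k (f (p x))) ≤ c * N₂ (p x) := by
        calc N₁ (k (f (p x))) ≤ |C₁| * (‖k‖ * (|B| * ‖p x‖)) := by
              refine (hN₁.le_norm _).trans (mul_le_mul (le_abs_self _) ?_ (norm_nonneg _)
                (abs_nonneg _))
              refine (k.le_opNorm _).trans ?_
              gcongr
              refine (f.le_opNorm _).trans ?_
              gcongr
              · exact (hB f hf).trans (le_abs_self B)
              · rfl
          _ = c * ‖p x‖ := by ring
          _ ≤ _ := by gcongr; exact hN₂.norm_le _
      rw [e2]
      rw [← e1] at i3
      have n1 : 0 ≤ N₁ (k x) := (norm_nonneg _).trans (hN₁.norm_le _)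
      have n2 : 0 ≤ N₂ (p x) := (norm_nonneg _).trans (hN₂.norm_le _)
      have j1 : r * N₁ (k x) ≤ ρ * N₁ (k x) := by gcongr; linarith
      have j2 := mul_le_mul_of_nonneg_left i2 (by linarith : 0 ≤ M)
      have j3 := mul_le_mul_of_nonneg_right hMc n2
      linarith
  exact ⟨ρ, hρ0, by simp only [ρ]; linarith, hN.growthBound hρ0⟩

end Reducible

/-- The nontrivial half of the Berger–Wang formula: a bounded family of endomorphisms whose
products have exponentially decaying spectral radii has exponentially decaying products. -/
theorem EigenvalueBound.exists_growthBound {V : Type u} [NormedAddCommGroup V] [NormedSpace ℂ V]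
    [FiniteDimensional ℂ V] {F : Set (V →L[ℂ] V)} {B : ℝ} (hB : ∀ f ∈ F, ‖f‖ ≤ B) {q : ℝ}
    (hq0 : 0 ≤ q) (hq : q < 1) (h : EigenvalueBound F q) :
    ∃ r, 0 ≤ r ∧ r < 1 ∧ GrowthBound F r := by
  induction hn : Module.finrank ℂ V using Nat.strong_induction_on generalizing V q B with
  | _ n ih =>
  rcases subsingleton_or_nontrivial V with hV | hV
  · exact ⟨0, le_rfl, one_pos, 1, fun L _ => by
      rw [Subsingleton.elim L.prod 0, norm_zero]
      positivity⟩
  by_contra hcon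
  -- Its infimum ρ is the joint spectral radius. Absence of decay means ρ ≥ 1, so dividing `F` by ρ
  -- makes the radius 1 and only decreases norms and eigenvalues.
  set U : Set ℝ := {s | 0 < s ∧ GrowthBound F s} with hU
  have hU1 : ∀ s ∈ U, 1 ≤ s := fun s hs => by
    by_contra hlt
    exact hcon ⟨s, hs.1.le, not_le.1 hlt, hs.2⟩
  have hUne : U.Nonempty := ⟨max B 0 + 1, by positivity,
    (GrowthBound.of_norm_le hB).mono (le_max_right _ _) (by linarith)⟩
  have hUbdd : BddBelow U := ⟨1, hU1⟩
  set ρ := sInf U with hρ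
  have hρ1 : 1 ≤ ρ := le_csInf hUne hU1
  have hρ0 : 0 < ρ := by linarith
  set c : ℂ := ((ρ⁻¹ : ℝ) : ℂ)
  have hc : c ≠ 0 := by simp [c, hρ0.ne']
  have hcn : ‖c‖ = ρ⁻¹ := by
    rw [Complex.norm_real, Real.norm_of_nonneg (by positivity)]
  set F₁ : Set (V →L[ℂ] V) := (fun f => c • f) '' F
  have hcon₁ : ¬ ∃ r, 0 ≤ r ∧ r < 1 ∧ GrowthBound F₁ r := by
    rintro ⟨r, hr0, hr1, hr⟩
    have h1 := (hr.mono hr0 (le_max_left r (1 / 2))).of_image_smul hc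
    rw [hcn, inv_inv] at h1
    have h2 : max r (1 / 2) < 1 := max_lt hr1 (by norm_num)
    have h3 : 0 < max r (1 / 2) := lt_max_of_lt_right (by norm_num)
    have h4 := csInf_le hUbdd (show ρ * max r (1 / 2) ∈ U from ⟨by positivity, h1⟩)
    nlinarith
  have hgrow₁ : ∀ t, 1 < t → GrowthBound F₁ t := by
    intro t ht
    obtain ⟨s, hs, hst⟩ := exists_lt_of_csInf_lt hUne (show sInf U < ρ * t by nlinarith)
    have h1 := (hs.2.mono hs.1.le hst.le).image_smul c
    rwa [hcn, inv_mul_cancel_left₀ hρ0.ne'] at h1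
  have hB₁ : ∀ f ∈ F₁, ‖f‖ ≤ B := by
    rintro _ ⟨f, hf, rfl⟩
    rw [norm_smul, hcn]
    exact (mul_le_of_le_one_left (norm_nonneg _) (inv_le_one_of_one_le₀ hρ1)).trans (hB f hf)
  have heig₁ : EigenvalueBound F₁ q := by
    intro L hL z hz
    refine (h.image_smul hc L hL z hz).trans (pow_le_pow_left₀ (by positivity) ?_ _)
    rw [hcn]
    exact mul_le_of_le_one_left hq0 (inv_le_one_of_one_le₀ hρ1)
  -- The vectors with bounded orbit: an invariant subspace, on which induction or uniform
  -- boundedness applies.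
  let K : Submodule ℂ V :=
    { carrier := {x | ∃ C, ∀ L : List (V →L[ℂ] V), (∀ f ∈ L, f ∈ F₁) → ‖L.prod x‖ ≤ C}
      zero_mem' := ⟨0, by simp⟩
      add_mem' := by
        rintro x y ⟨C, hC⟩ ⟨D, hD⟩
        refine ⟨C + D, fun L hL => ?_⟩
        rw [map_add]
        exact (norm_add_le _ _).trans (add_le_add (hC L hL) (hD L hL))
      smul_mem' := by
        rintro a x ⟨C, hC⟩
        refine ⟨‖a‖ * C, fun L hL => ?_⟩
        rw [map_smul, norm_smul]
        exact mul_le_mul_of_nonneg_left (hC L hL) (norm_nonneg a) }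
  have hKinv : ∀ f ∈ F₁, ∀ x ∈ K, f x ∈ K := by
    rintro f hf x ⟨C, hC⟩
    refine ⟨C, fun L hL => ?_⟩
    have := hC (L ++ [f]) (fun g hg => by
      rcases List.mem_append.1 hg with hg | hg
      · exact hL g hg
      · rw [List.mem_singleton.1 hg]; exact hf)
    simpa using this
  -- If all nonzero orbits were unbounded, growth would exceed some rate t > 1, against radius 1.
  have hKbot : K ≠ ⊥ := by
    intro hK
    obtain ⟨t, ht, hno⟩ := exists_not_growthBound (F := F₁) (fun x hx C => by
      by_contra hno
      push Not at hno
      exact hx ((Submodule.mem_bot ℂ).1 (hK ▸ (⟨C, hno⟩ : x ∈ K))))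
    exact hno (hgrow₁ t ht)
  by_cases hKtop : K = ⊤
  · have := FiniteDimensional.complete ℂ V
    obtain ⟨C, hC⟩ := banach_steinhaus
      (g := fun L : {L : List (V →L[ℂ] V) // ∀ f ∈ L, f ∈ F₁} => L.1.prod) (fun x => by
        obtain ⟨C, hC⟩ : x ∈ K := hKtop ▸ Submodule.mem_top
        exact ⟨C, fun L => hC L.1 L.2⟩)
    obtain ⟨D, N, hN⟩ := GrowthBound.exists_adaptedNorm (F := F₁) one_pos
      ⟨C, fun L hL => by simpa using hC ⟨L, hL⟩⟩
    exact hcon₁ (hN.exists_growthBound_lt_one hq0 hq heig₁)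
  · obtain ⟨K', hK'⟩ := K.exists_isCompl
    let k : V →L[ℂ] K := LinearMap.toContinuousLinearMap (K.projectionOnto K' hK')
    let p : V →L[ℂ] K' := LinearMap.toContinuousLinearMap (K'.projectionOnto K hK'.symm)
    have hkp : ∀ x, (k x : V) + p x = x := fun x => by
      exact Submodule.projection_add_projection_eq_self hK' x
    have hk : ∀ x : K, k x = x := fun x => by simp [k]
    have hp : ∀ x : K, p x = 0 := fun x => by simp [p]
    have hp' : ∀ x : K', p x = x := fun x => by simp [p]
    have hdim := Submodule.finrank_add_eq_of_isCompl hK'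
    have hK1 : Module.finrank ℂ K < n := hn ▸ Submodule.finrank_lt hKtop
    have hK2 : Module.finrank ℂ K' < n := by
      have : 0 < Module.finrank ℂ K := Submodule.one_le_finrank_iff.2 hKbot
      omega
    obtain ⟨r₁, hr₁, hr₁', h₁⟩ := ih _ hK1 (F := restrictFamily F₁ K) (B := |B|) (by
      rintro g ⟨f, hf, hfg⟩
      refine ContinuousLinearMap.opNorm_le_bound _ (abs_nonneg B) fun x => ?_
      rw [Submodule.coe_norm, hfg]
      exact (f.le_opNorm _).trans (mul_le_mul_of_nonneg_right
        ((hB₁ f hf).trans (le_abs_self B)) (norm_nonneg _))) hq0 hq (heig₁.restrict K) rfl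
    obtain ⟨r₂, hr₂, hr₂', h₂⟩ := ih _ hK2 (F := compressFamily F₁ p) (B := ‖p‖ * |B|) (by
      rintro g ⟨f, hf, hfg⟩
      refine ContinuousLinearMap.opNorm_le_bound _ (by positivity) fun x => ?_
      rw [hfg, mul_assoc]
      refine (p.le_opNorm _).trans (mul_le_mul_of_nonneg_left ?_ (norm_nonneg _))
      exact (f.le_opNorm _).trans (mul_le_mul_of_nonneg_right
        ((hB₁ f hf).trans (le_abs_self B)) (norm_nonneg _))) hq0 hq
      (heig₁.compress hp' fun f hf x => by
        have h0 := hp ⟨f (k x), hKinv f hf _ (k x).2⟩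
        simp only at h0
        conv_lhs => rw [← hkp x, map_add, map_add, h0, zero_add]) rfl
    exact hcon₁ (exists_growthBound_of_blocks hB₁ hkp hk hp hKinv hr₁ hr₁' hr₂ hr₂' h₁ h₂)

end JointSpectralRadius

open scoped Matrix.Norms.L2Operator

/-! ### Real matrices and their complex spectra -/

section ComplexAction

variable {d : ℕ}

theorem euclOpNorm_eq_norm (M : Mat d) : euclOpNorm M = ‖M‖ := rfl

/-- The spectrum of a real matrix, as a complex matrix. -/
def complexSpectrum (M : Mat d) : Set ℂ := spectrum ℂ (M.map (fun r : ℝ => (r : ℂ)))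

/-- The action of a real matrix on `ℂᵈ`. -/
def complexAction (M : Mat d) : (Fin d → ℂ) →L[ℂ] (Fin d → ℂ) :=
  LinearMap.toContinuousLinearMap (Matrix.toLin' (M.map (fun r : ℝ => (r : ℂ))))

theorem complexAction_apply (M : Mat d) (x : Fin d → ℂ) :
    complexAction M x = M.map (fun r : ℝ => (r : ℂ)) *ᵥ x := by
  simp [complexAction]

theorem complexAction_one : complexAction (1 : Mat d) = 1 := by
  ext x : 1
  rw [complexAction_apply, Matrix.map_one _ Complex.ofReal_zero Complex.ofReal_one]
  simp

theorem complexAction_mul (M N : Mat d) :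
    complexAction (M * N) = complexAction M * complexAction N := by
  ext x : 1
  rw [mul_apply_eq_comp, complexAction_apply, complexAction_apply, complexAction_apply,
    Matrix.mulVec_mulVec]
  congr 1
  exact Matrix.map_mul (f := Complex.ofRealHom)

theorem complexAction_list_prod (L : List (Mat d)) :
    complexAction L.prod = (L.map complexAction).prod := by
  induction L with
  | nil => exact complexAction_one
  | cons M L ih => rw [List.prod_cons, complexAction_mul, ih, List.map_cons, List.prod_cons]

theorem complexAction_pow (M : Mat d) (n : ℕ) :
    complexAction (M ^ n) = complexAction M ^ n := by
  rw [← List.prod_replicate, complexAction_list_prod, List.map_replicate, List.prod_replicate]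

/-- `complexAction` as a real linear map. -/
def complexActionLinear (d : ℕ) : Mat d →ₗ[ℝ] (Fin d → ℂ) →L[ℂ] (Fin d → ℂ) where
  toFun := complexAction
  map_add' M N := by
    ext x : 1
    simp only [_root_.add_apply, complexAction_apply, ← Matrix.add_mulVec]
    congr 1
    ext i j
    simp
  map_smul' c M := by
    ext x : 1
    simp only [RingHom.id_apply, _root_.smul_apply, complexAction_apply,
      ← Matrix.smul_mulVec]
    congr 1
    ext i j
    simp

theorem complexActionLinear_injective : Function.Injective (complexActionLinear d) := by
  intro M N h
  have h1 : Matrix.toLin' (M.map (fun r : ℝ => (r : ℂ))) =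
      Matrix.toLin' (N.map (fun r : ℝ => (r : ℂ))) := LinearMap.toContinuousLinearMap.injective h
  exact Matrix.map_injective Complex.ofReal_injective (Matrix.toLin'.injective h1)

theorem exists_norm_complexAction_le (d : ℕ) :
    ∃ c, 0 < c ∧ ∀ M : Mat d, ‖complexAction M‖ ≤ c * ‖M‖ := by
  let T := LinearMap.toContinuousLinearMap (complexActionLinear d)
  refine ⟨‖T‖ + 1, by positivity, fun M => (T.le_opNorm M).trans ?_⟩
  gcongr
  linarith

theorem exists_norm_le_complexAction (d : ℕ) :
    ∃ c, 0 < c ∧ ∀ M : Mat d, ‖M‖ ≤ c * ‖complexAction M‖ := by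
  obtain ⟨K, hK, h⟩ := (complexActionLinear d).exists_antilipschitzWith
    (LinearMap.ker_eq_bot.2 complexActionLinear_injective)
  refine ⟨K, by exact_mod_cast hK, fun M => ?_⟩
  exact h.le_mul_norm (map_zero _) M

theorem continuous_complexAction : Continuous (complexAction : Mat d → _) :=
  (complexActionLinear d).continuous_of_finiteDimensional

theorem hasEigenvalue_complexAction_iff {M : Mat d} {z : ℂ} :
    Module.End.HasEigenvalue (complexAction M : (Fin d → ℂ) →ₗ[ℂ] (Fin d → ℂ)) z ↔
      z ∈ complexSpectrum M := by
  rw [Module.End.hasEigenvalue_iff_mem_spectrum, complexSpectrum, ← Matrix.spectrum_toLin']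
  rfl

/-- A bounded family of real matrices whose products have exponentially decaying spectral radii
has exponentially decaying products. -/
theorem exists_norm_list_prod_le {F : Set (Mat d)} {B : ℝ} (hB : ∀ M ∈ F, ‖M‖ ≤ B) {q : ℝ}
    (hq0 : 0 ≤ q) (hq : q < 1) (h : ∀ L : List (Mat d), (∀ M ∈ L, M ∈ F) →
      ∀ z ∈ complexSpectrum L.prod, ‖z‖ ≤ q ^ L.length) :
    ∃ C r, 0 ≤ C ∧ 0 ≤ r ∧ r < 1 ∧ ∀ L : List (Mat d), (∀ M ∈ L, M ∈ F) →
      ‖L.prod‖ ≤ C * r ^ L.length := by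
  obtain ⟨c₁, hc₁, h₁⟩ := exists_norm_complexAction_le d
  obtain ⟨c₂, hc₂, h₂⟩ := exists_norm_le_complexAction d
  have heig : EigenvalueBound (complexAction '' F) q := by
    intro L hL z hz
    obtain ⟨L', h1, rfl⟩ : ∃ L' : List (Mat d), (∀ M ∈ L', M ∈ F) ∧ L'.map complexAction = L := by
      clear hz
      induction L with
      | nil => exact ⟨[], by simp, rfl⟩
      | cons g L ih =>
        obtain ⟨L', h1, h2⟩ := ih fun f hf => hL f (by simp [hf])
        obtain ⟨M, hM, hMg⟩ := hL g (by simp)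
        refine ⟨M :: L', ?_, by simp [h2, hMg]⟩
        intro k hk
        rcases List.mem_cons.1 hk with rfl | hk
        exacts [hM, h1 k hk]
    rw [← complexAction_list_prod] at hz
    rw [List.length_map]
    exact h L' h1 z (hasEigenvalue_complexAction_iff.1 hz)
  obtain ⟨r, hr0, hr1, C, hC⟩ := heig.exists_growthBound (B := c₁ * B) (by
    rintro _ ⟨M, hM, rfl⟩
    exact (h₁ M).trans (by gcongr; exact hB M hM)) hq0 hq
  refine ⟨c₂ * |C|, r, by positivity, hr0, hr1, fun L hL => ?_⟩
  have := hC (L.map complexAction) (by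
    intro f hf
    obtain ⟨M, hM, rfl⟩ := List.mem_map.1 hf
    exact ⟨M, hL M hM, rfl⟩)
  rw [← complexAction_list_prod, List.length_map] at this
  calc ‖L.prod‖ ≤ c₂ * ‖complexAction L.prod‖ := h₂ _
    _ ≤ c₂ * (|C| * r ^ L.length) := by
      gcongr
      exact this.trans (by gcongr; exact le_abs_self C)
    _ = _ := by ring

/-- Eigenvalues depend lower semicontinuously on the matrix. -/
theorem eventually_exists_mem_complexSpectrum {ι : Type*} {l : Filter ι} {M : ι → Mat d}
    {M₀ : Mat d} (hM : Tendsto M l (𝓝 M₀)) {z : ℂ} (hz : z ∈ complexSpectrum M₀) {η : ℝ}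
    (hη : 0 < η) : ∀ᶠ i in l, ∃ w ∈ complexSpectrum (M i), ‖z - w‖ < η := by
  let D : Mat d → ℝ := fun M => ‖(z • (1 : (Fin d → ℂ) →L[ℂ] (Fin d → ℂ)) - complexAction M).det‖
  have hD : Continuous D :=
    (ContinuousLinearMap.continuous_det.comp
      (continuous_const.sub continuous_complexAction)).norm
  have hD0 : D M₀ = 0 := by
    rw [← hasEigenvalue_complexAction_iff, Module.End.hasEigenvalue_iff_isRoot_charpoly,
      Polynomial.IsRoot, LinearMap.eval_charpoly] at hz
    simp only [D, norm_eq_zero]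
    rw [← hz]
    rfl
  have hlim : Tendsto (fun i => D (M i)) l (𝓝 0) := hD0 ▸ (hD.tendsto M₀).comp hM
  -- Without an eigenvalue within η of z, |det(z − M i)| would be at least η^d, whereas it tends to
  -- |det(z − M₀)| = 0.
  filter_upwards [hlim.eventually_lt_const (pow_pos hη (Module.finrank ℂ (Fin d → ℂ)))] with i hi
  by_contra hno
  push Not at hno
  have := pow_le_norm_det_of_le_dist (f := (complexAction (M i) : (Fin d → ℂ) →ₗ[ℂ] (Fin d → ℂ)))
    (w := z) hη.le (fun w hw => hno w (hasEigenvalue_complexAction_iff.1 hw))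
  exact absurd hi (not_lt.2 this)

/-- Apply M^n to an eigenvector. The constant only compares the norms of the real matrix and of its
complex action, so it depends neither on M nor on n. -/
theorem exists_norm_pow_le_of_mem_complexSpectrum (d : ℕ) :
    ∃ c, 0 < c ∧ ∀ (M : Mat d) (z : ℂ), z ∈ complexSpectrum M → ∀ n : ℕ,
      ‖z‖ ^ n ≤ c * ‖M ^ n‖ := by
  obtain ⟨c, hc, h⟩ := exists_norm_complexAction_le d
  refine ⟨c, hc, fun M z hz n => ?_⟩
  obtain ⟨x, hx⟩ := (hasEigenvalue_complexAction_iff.2 hz).exists_hasEigenvector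
  have hpow : complexAction (M ^ n) x = z ^ n • x := by
    rw [complexAction_pow]
    have := hx.pow_apply n
    rw [← this]
    clear this
    induction n with
    | zero => rfl
    | succ n ih => rw [pow_succ', pow_succ', mul_apply_eq_comp, ih]; rfl
  refine le_trans ?_ (h (M ^ n))
  have h1 := (complexAction (M ^ n)).le_opNorm x
  rw [hpow, norm_smul, norm_pow] at h1
  exact le_of_mul_le_mul_right h1 (norm_pos_iff.2 hx.2)

theorem exp_mem_complexSpectrum {M : Mat d} {z : ℂ} (hz : z ∈ complexSpectrum M) :
    Complex.exp z ∈ complexSpectrum (NormedSpace.exp M) := by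
  have h1 := spectrum.exp_mem_exp _ hz
  have h2 : (NormedSpace.exp M).map (fun r : ℝ => (r : ℂ)) =
      NormedSpace.exp (M.map (fun r : ℝ => (r : ℂ))) :=
    NormedSpace.map_exp_of_mem_ball (𝕂 := ℝ)
      (Complex.ofRealHom.mapMatrix : Mat d →+* Matrix (Fin d) (Fin d) ℂ)
      (continuous_id.matrix_map Complex.continuous_ofReal) M
      ((NormedSpace.expSeries_radius_eq_top ℝ (Mat d)).symm ▸ edist_lt_top _ _)
  rw [complexSpectrum, h2, Complex.exp_eq_exp_ℂ]
  exact h1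

theorem spectralAbscissa_eq (M : Mat d) :
    spectralAbscissa M = ⨆ z ∈ complexSpectrum M, (z.re : EReal) := rfl

end ComplexAction

/-! ### Words of timed pieces -/

section Words

variable {α : Type*} {d : ℕ}

/-- The flow, final jumps included, along a list of pairs (duration, mode), the last piece in time
being the head of the list. -/
def word (G R : α → Mat d) (l : List (ℝ × α)) : Mat d :=
  (l.map fun p => R p.2 * NormedSpace.exp (p.1 • G p.2)).prod

/-- The total duration of a word. -/
def duration (l : List (ℝ × α)) : ℝ := (l.map Prod.fst).sum

/-- The pieces of `l` have positive durations and modes in `S`. -/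
def IsPositive (S : Set α) (l : List (ℝ × α)) : Prop := ∀ p ∈ l, 0 < p.1 ∧ p.2 ∈ S

@[simp] theorem word_nil (G R : α → Mat d) : word G R [] = 1 := rfl

@[simp] theorem word_cons (G R : α → Mat d) (p : ℝ × α) (l : List (ℝ × α)) :
    word G R (p :: l) = R p.2 * NormedSpace.exp (p.1 • G p.2) * word G R l := by
  simp [word]

@[simp] theorem word_append (G R : α → Mat d) (l l' : List (ℝ × α)) :
    word G R (l ++ l') = word G R l * word G R l' := by
  simp [word]

@[simp] theorem duration_nil : duration ([] : List (ℝ × α)) = 0 := rfl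

@[simp] theorem duration_cons (p : ℝ × α) (l : List (ℝ × α)) :
    duration (p :: l) = p.1 + duration l := by
  simp [duration]

@[simp] theorem duration_append (l l' : List (ℝ × α)) :
    duration (l ++ l') = duration l + duration l' := by
  simp [duration]

theorem IsPositive.nil (S : Set α) : IsPositive S ([] : List (ℝ × α)) := by simp [IsPositive]

theorem isPositive_cons {S : Set α} {p : ℝ × α} {l : List (ℝ × α)} :
    IsPositive S (p :: l) ↔ (0 < p.1 ∧ p.2 ∈ S) ∧ IsPositive S l := by
  simp [IsPositive]

theorem isPositive_append {S : Set α} {l l' : List (ℝ × α)} :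
    IsPositive S (l ++ l') ↔ IsPositive S l ∧ IsPositive S l' := by
  simp only [IsPositive, List.mem_append]
  exact ⟨fun h => ⟨fun p hp => h p (Or.inl hp), fun p hp => h p (Or.inr hp)⟩,
    fun h p hp => hp.elim (h.1 p) (h.2 p)⟩

theorem IsPositive.duration_nonneg {S : Set α} {l : List (ℝ × α)} (h : IsPositive S l) :
    0 ≤ duration l := by
  induction l with
  | nil => simp
  | cons p l ih =>
    rw [isPositive_cons] at h
    rw [duration_cons]
    linarith [ih h.2, h.1.1]

theorem IsPositive.duration_pos {S : Set α} {l : List (ℝ × α)} (h : IsPositive S l)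
    (hl : l ≠ []) : 0 < duration l := by
  cases l with
  | nil => exact absurd rfl hl
  | cons p l =>
    rw [isPositive_cons] at h
    rw [duration_cons]
    linarith [h.2.duration_nonneg, h.1.1]

theorem exists_word_eq_pow {S : Set α} {l : List (ℝ × α)} (h : IsPositive S l) (n : ℕ) :
    ∃ l', IsPositive S l' ∧ duration l' = n * duration l ∧
      ∀ G R : α → Mat d, word G R l' = word G R l ^ n := by
  induction n with
  | zero => exact ⟨[], IsPositive.nil S, by simp, by simp⟩
  | succ n ih =>
    obtain ⟨l', h1, h2, h3⟩ := ih
    refine ⟨l ++ l', isPositive_append.2 ⟨h, h1⟩, ?_, fun G R => ?_⟩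
    · rw [duration_append, h2]
      push_cast
      ring
    · rw [word_append, h3, pow_succ']

/-- Multiply all durations by `c`. -/
def scale (c : ℝ) (l : List (ℝ × α)) : List (ℝ × α) := l.map fun p => (c * p.1, p.2)

theorem word_scale {c : ℝ} {G G' : α → Mat d} (hG : ∀ a, c • G a = G' a) (R : α → Mat d)
    (l : List (ℝ × α)) : word G R (scale c l) = word G' R l := by
  induction l with
  | nil => rfl
  | cons p l ih =>
    rw [word_cons, ← ih, scale, List.map_cons, word_cons, ← hG, smul_smul, mul_comm]
    rfl

theorem duration_scale (c : ℝ) (l : List (ℝ × α)) : duration (scale c l) = c * duration l := by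
  induction l with
  | nil => simp [scale]
  | cons p l ih => rw [duration_cons, mul_add, ← ih, scale, List.map_cons, duration_cons]; rfl

theorem IsPositive.scale {S : Set α} {l : List (ℝ × α)} (h : IsPositive S l) {c : ℝ}
    (hc : 0 < c) : IsPositive S (scale c l) := by
  intro p hp
  obtain ⟨p', hp', rfl⟩ := List.mem_map.1 hp
  exact ⟨mul_pos hc (h p' hp').1, (h p' hp').2⟩

end Words

/-! ### Flows of signals as words -/

namespace Signal

variable {α : Type*} {S : Set α} {d : ℕ}

theorem index_spec {τ : ℝ} (s : Signal S τ) {t : ℝ} (ht : 0 ≤ t) :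
    (s.index t : ℕ∞) ≤ s.N ∧ s.time (s.index t) ≤ t ∧
      (((s.index t + 1 : ℕ) : ℕ∞) ≤ s.N → t < s.time (s.index t + 1)) := by
  set A : Set ℕ := {k : ℕ | (k : ℕ∞) ≤ s.N ∧ s.time k ≤ t} with hA
  have hne : A.Nonempty := ⟨0, by simp, by rw [s.time_zero]; exact ht⟩
  have hbdd : BddAbove A := by
    by_cases hN : s.N = ⊤
    · obtain ⟨m, hm⟩ := eventually_atTop.1 ((s.locally_finite hN).eventually_gt_atTop t)
      refine ⟨m, fun k hk => ?_⟩
      by_contra hlt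
      exact absurd hk.2 (not_le.2 (hm k (by omega)))
    · obtain ⟨m, hm⟩ := ENat.ne_top_iff_exists.1 hN
      refine ⟨m, fun k hk => ?_⟩
      have := hk.1
      rw [← hm] at this
      exact_mod_cast this
  have hmem : s.index t ∈ A := Nat.sSup_mem hne hbdd
  refine ⟨hmem.1, hmem.2, fun h => ?_⟩
  by_contra hlt
  have : s.index t + 1 ≤ s.index t := le_csSup hbdd ⟨h, not_lt.1 hlt⟩
  omega

theorem exists_flowAtSwitch_eq_word {τ : ℝ} (s : Signal S τ) (k : ℕ) (hk : (k : ℕ∞) ≤ s.N) :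
    ∃ l, IsPositive S l ∧ duration l = s.time k ∧
      ∀ G R : α → Mat d, s.flowAtSwitch G R k = word G R l := by
  induction k with
  | zero => exact ⟨[], IsPositive.nil S, by simp [s.time_zero], fun G R => rfl⟩
  | succ k ih =>
    have hk' : (k : ℕ∞) ≤ s.N := le_trans (by exact_mod_cast Nat.le_succ k) hk
    obtain ⟨l, h1, h2, h3⟩ := ih hk'
    refine ⟨(s.time (k + 1) - s.time k, s.mode k) :: l, isPositive_cons.2
      ⟨⟨sub_pos.2 (s.time_lt k hk), s.mode_mem k hk'⟩, h1⟩, ?_, fun G R => ?_⟩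
    · rw [duration_cons, h2]
      ring
    · rw [word_cons, flowAtSwitch, h3]

theorem exists_flow_eq_word {τ : ℝ} (s : Signal S τ) {t : ℝ} (ht : 0 ≤ t) :
    ∃ l r a, IsPositive S l ∧ 0 ≤ r ∧ a ∈ S ∧ r + duration l = t ∧
      ∀ G R : α → Mat d, s.flow G R t = NormedSpace.exp (r • G a) * word G R l := by
  obtain ⟨h1, h2, -⟩ := s.index_spec ht
  obtain ⟨l, hl, hd, hw⟩ := s.exists_flowAtSwitch_eq_word (d := d) (s.index t) h1
  refine ⟨l, t - s.time (s.index t), s.mode (s.index t), hl, sub_nonneg.2 h2,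
    s.mode_mem _ h1, ?_, fun G R => ?_⟩
  · rw [hd]
    ring
  · rw [← hw]
    rfl

/-- The signal without switchings. -/
def const {a : α} (ha : a ∈ S) : Signal S 0 where
  N := 0
  time := fun k => k
  mode := fun _ => a
  time_zero := by simp
  time_lt := fun k _ => by simp
  dwell := fun k _ => by simp
  locally_finite := fun h => absurd h (by simp)
  mode_mem := fun _ _ => ha

theorem flow_const {a : α} (ha : a ∈ S) (G R : α → Mat d) {t : ℝ} (ht : 0 ≤ t) :
    (const ha).flow G R t = NormedSpace.exp (t • G a) := by
  rw [flow_eq (const ha) G R (k := 0) (by simp) (by simpa [const] using ht) (by simp [const])]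
  simp [const, flowAtSwitch]

/-- The signal that stays in mode `a` for a time `h` and then follows `s`. -/
def cons (s : Signal S 0) {a : α} (ha : a ∈ S) {h : ℝ} (hh : 0 < h) : Signal S 0 where
  N := s.N + 1
  time := fun k => Nat.casesOn k 0 fun k => h + s.time k
  mode := fun k => Nat.casesOn k a fun k => s.mode k
  time_zero := rfl
  time_lt := fun k hk => by
    cases k with
    | zero => simpa [s.time_zero] using hh
    | succ k =>
      have hk' : ((k + 1 : ℕ) : ℕ∞) ≤ s.N :=
        (ENat.add_le_add_iff_right (k := 1) (by simp)).1 (by exact_mod_cast hk)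
      simpa using s.time_lt k hk'
  dwell := fun k hk => by
    cases k with
    | zero => simpa [s.time_zero] using hh.le
    | succ k =>
      have hk' : ((k + 1 : ℕ) : ℕ∞) ≤ s.N :=
        (ENat.add_le_add_iff_right (k := 1) (by simp)).1 (by exact_mod_cast hk)
      simpa using (s.time_lt k hk').le
  locally_finite := fun hN => by
    have hN' : s.N = ⊤ := by
      by_contra hne
      obtain ⟨m, hm⟩ := ENat.ne_top_iff_exists.1 hne
      rw [← hm] at hN
      exact ENat.natCast_ne_top (m + 1) (by exact_mod_cast hN)
    refine (tendsto_add_atTop_iff_nat 1).1 ?_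
    exact tendsto_atTop_add_const_left _ h (s.locally_finite hN')
  mode_mem := fun k hk => by
    cases k with
    | zero => exact ha
    | succ k =>
      exact s.mode_mem k ((ENat.add_le_add_iff_right (k := 1) (by simp)).1 (by exact_mod_cast hk))

theorem flowAtSwitch_cons (s : Signal S 0) {a : α} (ha : a ∈ S) {h : ℝ} (hh : 0 < h)
    (G R : α → Mat d) (k : ℕ) :
    (s.cons ha hh).flowAtSwitch G R (k + 1) =
      s.flowAtSwitch G R k * (R a * NormedSpace.exp (h • G a)) := by
  induction k with
  | zero => simp [flowAtSwitch, cons, s.time_zero]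
  | succ k ih =>
    rw [flowAtSwitch, ih, flowAtSwitch]
    simp [cons, mul_assoc]

theorem flow_cons (s : Signal S 0) {a : α} (ha : a ∈ S) {h : ℝ} (hh : 0 < h)
    (G R : α → Mat d) {t : ℝ} (ht : 0 ≤ t) :
    (s.cons ha hh).flow G R (h + t) =
      s.flow G R t * (R a * NormedSpace.exp (h • G a)) := by
  obtain ⟨h1, h2, h3⟩ := s.index_spec ht
  rw [flow_eq (s.cons ha hh) G R (k := s.index t + 1) (t := h + t), flowAtSwitch_cons, flow]
  · simp [cons, mul_assoc]
  · simp only [cons]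
    exact_mod_cast add_le_add_left h1 1
  · simpa [cons] using h2
  · intro hk
    have := h3 ((ENat.add_le_add_iff_right (k := 1) (by simp)).1 (by exact_mod_cast hk))
    simpa [cons] using this

theorem exists_flow_eq_exp_mul_word {a : α} (ha : a ∈ S) {r : ℝ} (hr : 0 ≤ r)
    {l : List (ℝ × α)} (hl : IsPositive S l) :
    ∃ s : Signal S 0, ∀ G R : α → Mat d,
      s.flow G R (r + duration l) = NormedSpace.exp (r • G a) * word G R l := by
  -- The last entry of the list acts first in time, so the signal is built by prepending pieces to a
  -- constant one.
  induction l using List.reverseRecOn with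
  | nil => exact ⟨const ha, fun G R => by simpa using flow_const ha G R hr⟩
  | append_singleton l p ih =>
    obtain ⟨hl1, hl2⟩ := isPositive_append.1 hl
    obtain ⟨s, hs⟩ := ih hl1
    obtain ⟨hp, hpS⟩ := hl2 p (by simp)
    refine ⟨s.cons hpS hp, fun G R => ?_⟩
    have : r + duration (l ++ [p]) = p.1 + (r + duration l) := by simp; ring
    rw [this, flow_cons _ _ _ _ _ (add_nonneg hr hl1.duration_nonneg), hs]
    simp [mul_assoc]

end Signal

/-! ### Lyapunov exponents and exponential bounds -/

section Lyapunov

variable {α : Type*} {S : Set α} {d : ℕ}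

theorem log_div_le_iff {y μ t : ℝ} (ht : 0 < t) :
    ENNReal.log (ENNReal.ofReal y) / (t : EReal) ≤ (μ : EReal) ↔ y ≤ Real.exp (μ * t) := by
  rw [EReal.div_le_iff_le_mul (by exact_mod_cast ht) (EReal.coe_ne_top t), ← EReal.coe_mul,
    ← ENNReal.logOrderIso_apply, ← OrderIso.le_symm_apply, ENNReal.logOrderIso_symm,
    EReal.expOrderIso_apply, EReal.exp_coe, ENNReal.ofReal_le_ofReal_iff (Real.exp_pos _).le,
    mul_comm]

/-- For every ν > μ the constant C is eventually absorbed by e^{(ν−μ)t}. -/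
theorem maxLyapunov_le {τ : ℝ} {G R : α → Mat d} {C μ : ℝ}
    (h : ∀ (s : Signal S τ) (t : ℝ), 0 ≤ t → ‖s.flow G R t‖ ≤ C * Real.exp (μ * t)) :
    maxLyapunov S τ G R ≤ (μ : EReal) := by
  refine EReal.le_of_forall_lt_iff_le.1 fun ν hν => ?_
  have hν' : μ < ν := by exact_mod_cast hν
  have hlim : Tendsto (fun t : ℝ => Real.exp ((ν - μ) * t)) atTop atTop :=
    Real.tendsto_exp_atTop.comp (tendsto_id.const_mul_atTop (sub_pos.2 hν'))
  refine Filter.limsup_le_of_le (h := ?_)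
  filter_upwards [hlim.eventually_ge_atTop C, eventually_gt_atTop 0] with t hC ht
  refine iSup_le fun s => (log_div_le_iff ht).2 ((h s t ht.le).trans ?_)
  calc C * Real.exp (μ * t) ≤ Real.exp ((ν - μ) * t) * Real.exp (μ * t) := by gcongr
    _ = _ := by rw [← Real.exp_add]; ring_nf

theorem eventually_norm_flow_le_of_maxLyapunov_lt {τ : ℝ} {G R : α → Mat d} {μ : ℝ}
    (h : maxLyapunov S τ G R < (μ : EReal)) :
    ∀ᶠ t in atTop, ∀ s : Signal S τ, ‖s.flow G R t‖ ≤ Real.exp (μ * t) := by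
  filter_upwards [eventually_lt_of_limsup_lt h, eventually_gt_atTop 0] with t h1 ht s
  exact (log_div_le_iff ht).1 ((le_iSup _ s).trans h1.le)

theorem le_maxLyapunov {τ : ℝ} {G R : α → Mat d} {μ : ℝ}
    (h : ∃ᶠ t in atTop, ∃ s : Signal S τ, Real.exp (μ * t) < ‖s.flow G R t‖) :
    (μ : EReal) ≤ maxLyapunov S τ G R := by
  refine le_limsup_of_frequently_le ?_
  refine (h.and_eventually (eventually_gt_atTop 0)).mono ?_
  rintro t ⟨⟨s, hs⟩, ht⟩
  refine le_trans (le_of_not_ge fun hle => ?_) (le_iSup _ s)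
  exact absurd hs (not_lt.2 ((log_div_le_iff ht).1 hle))

end Lyapunov

/-! ### Perturbation of the generators -/

section Perturbation

variable {α : Type*} {d : ℕ}

/-- All flows of duration `t` have norm at most `C e^{μt}`. -/
def WordBound (S : Set α) (G R : α → Mat d) (C μ : ℝ) : Prop :=
  ∀ l, IsPositive S l → ∀ a ∈ S, ∀ r : ℝ, 0 ≤ r →
    ‖NormedSpace.exp (r • G a) * word G R l‖ ≤ C * Real.exp (μ * (r + duration l))

/-- Flows of duration `t` starting in mode `a`, with nonnegative durations of the pieces. -/
inductive Evolution (S : Set α) (G R : α → Mat d) : α → Mat d → ℝ → Prop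
  | flow {a : α} (ha : a ∈ S) {h : ℝ} (hh : 0 ≤ h) :
      Evolution S G R a (NormedSpace.exp (h • G a)) h
  | jump {a b : α} (ha : a ∈ S) {A : Mat d} {t : ℝ} (hA : Evolution S G R b A t) {h : ℝ}
      (hh : 0 ≤ h) : Evolution S G R a (A * (R a * NormedSpace.exp (h • G a))) (t + h)

variable {S : Set α} {G G' R : α → Mat d} {C μ : ℝ}

theorem exp_add_smul (r s : ℝ) (A : Mat d) :
    NormedSpace.exp ((r + s) • A) = NormedSpace.exp (r • A) * NormedSpace.exp (s • A) := by
  rw [add_smul]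
  exact Matrix.exp_add_of_commute _ _ (((Commute.refl A).smul_left r).smul_right s)

theorem exp_nsmul_smul (n : ℕ) (r : ℝ) (A : Mat d) :
    NormedSpace.exp ((n * r) • A) = NormedSpace.exp (r • A) ^ n := by
  rw [← Matrix.exp_nsmul, mul_smul, Nat.cast_smul_eq_nsmul]

theorem continuous_matrix_exp : Continuous (NormedSpace.exp : Mat d → Mat d) := by
  let _ : NormedAlgebra ℚ (Mat d) := NormedAlgebra.restrictScalars ℚ ℝ _
  exact NormedSpace.exp_continuous

theorem Evolution.comp_flow {a : α} {A : Mat d} {t : ℝ} (hA : Evolution S G R a A t) {h : ℝ}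
    (hh : 0 ≤ h) : Evolution S G R a (A * NormedSpace.exp (h • G a)) (t + h) := by
  cases hA with
  | flow ha hr =>
    rw [← exp_add_smul]
    exact .flow ha (add_nonneg hr hh)
  | jump ha hA hr =>
    rw [mul_assoc, mul_assoc, ← exp_add_smul, add_assoc]
    exact .jump ha hA (add_nonneg hr hh)

theorem Evolution.comp_jump {a b : α} (ha : a ∈ S) {A : Mat d} {t : ℝ}
    (hA : Evolution S G R b A t) : Evolution S G R a (A * R a) t := by
  simpa using Evolution.jump ha hA le_rfl

theorem Evolution.exists_word {a : α} {A : Mat d} {t : ℝ} (hA : Evolution S G R a A t) :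
    ∃ l r b, (∀ p ∈ l, 0 ≤ p.1 ∧ p.2 ∈ S) ∧ 0 ≤ r ∧ b ∈ S ∧ t = r + duration l ∧
      A = NormedSpace.exp (r • G b) * word G R l := by
  induction hA with
  | @flow a ha h hh => exact ⟨[], h, a, by simp, hh, ha, by simp, by simp⟩
  | @jump a b ha A t hA h hh ih =>
    obtain ⟨l, r, c, hl, hr, hc, rfl, rfl⟩ := ih
    refine ⟨l ++ [(h, a)], r, c, ?_, hr, hc, by simp; ring, by simp [mul_assoc]⟩
    intro p hp
    rcases List.mem_append.1 hp with hp | hp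
    · exact hl p hp
    · rw [List.mem_singleton.1 hp]
      exact ⟨hh, ha⟩

/-- Pieces of zero duration, which signals exclude, are limits of pieces of positive duration, and
the bound is closed. They are needed so that an evolution may jump immediately. -/
theorem WordBound.evolution_le (hb : WordBound S G R C μ) {a : α} {A : Mat d} {t : ℝ}
    (hA : Evolution S G R a A t) : ‖A‖ ≤ C * Real.exp (μ * t) := by
  obtain ⟨l, r, b, hl, hr, hbS, rfl, rfl⟩ := hA.exists_word
  let shift : ℝ → List (ℝ × α) := fun h => l.map fun p => (p.1 + h, p.2)
  have hword : Tendsto (fun h => word G R (shift h)) (𝓝[>] 0) (𝓝 (word G R l)) := by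
    simp only [shift]
    clear hl hA
    induction l with
    | nil => exact tendsto_const_nhds
    | cons p l ih =>
      simp only [List.map_cons, word_cons]
      refine Tendsto.mul (Tendsto.mul tendsto_const_nhds ?_) ih
      have hc : Continuous fun h : ℝ => NormedSpace.exp ((p.1 + h) • G p.2) :=
        continuous_matrix_exp.comp (by fun_prop)
      simpa using (hc.tendsto 0).mono_left nhdsWithin_le_nhds
  have hdur : Tendsto (fun h => duration (shift h)) (𝓝[>] 0) (𝓝 (duration l)) := by
    simp only [shift]
    clear hl hA hword
    induction l with
    | nil => exact tendsto_const_nhds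
    | cons p l ih =>
      simp only [List.map_cons, duration_cons]
      refine Tendsto.add ?_ ih
      have hc : Continuous fun h : ℝ => p.1 + h := by fun_prop
      simpa using (hc.tendsto 0).mono_left nhdsWithin_le_nhds
  refine le_of_tendsto_of_tendsto (tendsto_const_nhds.mul hword).norm
    (((Real.continuous_exp.tendsto _).comp
      ((tendsto_const_nhds (x := r)).add hdur |>.const_mul μ)).const_mul C) ?_
  filter_upwards [self_mem_nhdsWithin] with h hh
  refine hb _ (fun p hp => ?_) b hbS r hr
  obtain ⟨p', hp', rfl⟩ := List.mem_map.1 hp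
  exact ⟨add_pos_of_nonneg_of_pos (hl p' hp').1 hh, (hl p' hp').2⟩

/-- The weighted supremum of the flows that start in mode `a`, applied to `X`. -/
def modeNorm (S : Set α) (G R : α → Mat d) (μ : ℝ) (a : α) (X : Mat d) : ℝ :=
  sSup {y | ∃ A t, Evolution S G R a A t ∧ y = Real.exp (-(μ * t)) * ‖A * X‖}

theorem WordBound.le_modeNorm (hb : WordBound S G R C μ) {a : α} {A : Mat d} {t : ℝ}
    (hA : Evolution S G R a A t) (X : Mat d) :
    Real.exp (-(μ * t)) * ‖A * X‖ ≤ modeNorm S G R μ a X := by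
  refine le_csSup ⟨C * ‖X‖, ?_⟩ ⟨A, t, hA, rfl⟩
  rintro _ ⟨A, t, hA, rfl⟩
  calc _ ≤ Real.exp (-(μ * t)) * ((C * Real.exp (μ * t)) * ‖X‖) := by
        gcongr
        exact (norm_mul_le _ _).trans (by gcongr; exact hb.evolution_le hA)
    _ = (Real.exp (-(μ * t)) * Real.exp (μ * t)) * (C * ‖X‖) := by ring
    _ = _ := by rw [← Real.exp_add]; simp

theorem modeNorm_le {a : α} (ha : a ∈ S) {X : Mat d} {B : ℝ}
    (h : ∀ A t, Evolution S G R a A t → Real.exp (-(μ * t)) * ‖A * X‖ ≤ B) :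
    modeNorm S G R μ a X ≤ B :=
  csSup_le ⟨_, _, _, .flow ha le_rfl, rfl⟩ (by rintro _ ⟨A, t, hA, rfl⟩; exact h A t hA)

theorem WordBound.modeNorm_le_norm (hb : WordBound S G R C μ) {a : α} (ha : a ∈ S) (X : Mat d) :
    modeNorm S G R μ a X ≤ C * ‖X‖ := by
  refine modeNorm_le ha fun A t hA => ?_
  calc _ ≤ Real.exp (-(μ * t)) * ((C * Real.exp (μ * t)) * ‖X‖) := by
        gcongr
        exact (norm_mul_le _ _).trans (by gcongr; exact hb.evolution_le hA)
    _ = (Real.exp (-(μ * t)) * Real.exp (μ * t)) * (C * ‖X‖) := by ring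
    _ = _ := by rw [← Real.exp_add]; simp

theorem WordBound.norm_le_modeNorm (hb : WordBound S G R C μ) {a : α} (ha : a ∈ S) (X : Mat d) :
    ‖X‖ ≤ modeNorm S G R μ a X := by
  simpa using hb.le_modeNorm (.flow ha le_rfl) X

theorem WordBound.modeNorm_add_le (hb : WordBound S G R C μ) {a : α} (ha : a ∈ S)
    (X Y : Mat d) : modeNorm S G R μ a (X + Y) ≤ modeNorm S G R μ a X + modeNorm S G R μ a Y := by
  refine modeNorm_le ha fun A t hA => ?_
  refine le_trans ?_ (add_le_add (hb.le_modeNorm hA X) (hb.le_modeNorm hA Y))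
  rw [← mul_add, mul_add]
  gcongr
  exact norm_add_le _ _

theorem WordBound.modeNorm_flow_le (hb : WordBound S G R C μ) {a : α} (ha : a ∈ S) {h : ℝ}
    (hh : 0 ≤ h) (X : Mat d) :
    modeNorm S G R μ a (NormedSpace.exp (h • G a) * X) ≤
      Real.exp (μ * h) * modeNorm S G R μ a X := by
  refine modeNorm_le ha fun A t hA => ?_
  have := mul_le_mul_of_nonneg_left (hb.le_modeNorm (hA.comp_flow hh) X) (Real.exp_pos (μ * h)).le
  rw [← mul_assoc, ← Real.exp_add] at this
  rw [← mul_assoc]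
  refine le_trans (le_of_eq ?_) this
  congr 2
  ring

/-- A jump out of a followed by an evolution from b is itself an evolution from a, so jumps cost no
constant. The norm must depend on the mode: flowing in a and then in b without the jump R a is not a
flow of the system and need not obey the bound. -/
theorem WordBound.modeNorm_jump_le (hb : WordBound S G R C μ) {a b : α} (ha : a ∈ S)
    (hbS : b ∈ S) (X : Mat d) : modeNorm S G R μ b (R a * X) ≤ modeNorm S G R μ a X := by
  refine modeNorm_le hbS fun A t hA => ?_
  rw [← mul_assoc]
  exact hb.le_modeNorm (hA.comp_jump ha) X

/-- Over a short step r the two exponentials differ by at most δr, which costs CδrN(X) in the mode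
norm. As μ ≥ 0, e^{μr} + Cδr ≤ e^{(μ+Cδ)r}; iterate over h/r steps. -/
theorem WordBound.modeNorm_perturbed_flow_le (hb : WordBound S G R C μ) (hμ : 0 ≤ μ) {a : α}
    (ha : a ∈ S) {A : Mat d} {δ : ℝ} (hδ : ‖A - G a‖ < δ) {h : ℝ} (hh : 0 ≤ h) (X : Mat d) :
    modeNorm S G R μ a (NormedSpace.exp (h • A) * X) ≤
      Real.exp ((μ + C * δ) * h) * modeNorm S G R μ a X := by
  set N := modeNorm S G R μ a
  have hC : 0 ≤ C := by
    have := hb.evolution_le (.flow (a := a) ha le_rfl)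
    simp only [mul_zero, Real.exp_zero, mul_one] at this
    exact (norm_nonneg _).trans this
  have hδ0 : 0 ≤ δ := (norm_nonneg _).trans hδ.le
  have hN0 : ∀ X, 0 ≤ N X := fun X => (norm_nonneg X).trans (hb.norm_le_modeNorm ha X)
  have hsmall : ∀ᶠ r : ℝ in 𝓝[≥] 0,
      ‖NormedSpace.exp (r • A) - NormedSpace.exp (r • G a)‖ ≤ δ * r := by
    have h1 : HasDerivAt (fun r : ℝ => NormedSpace.exp (r • A) - NormedSpace.exp (r • G a))
        (A - G a) 0 := by
      have h2 := (hasDerivAt_exp_smul_const (𝕂 := ℝ) A 0).sub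
        (hasDerivAt_exp_smul_const (𝕂 := ℝ) (G a) 0)
      exact h2.congr_deriv (by simp)
    -- The strict inequality ‖A − G a‖ < δ leaves room for the second-order remainder.
    have h3 := h1.isLittleO.bound (c := δ - ‖A - G a‖) (by linarith)
    filter_upwards [nhdsWithin_le_nhds h3, self_mem_nhdsWithin] with r hr hr0
    have hr0' : 0 ≤ r := hr0
    simp only [zero_smul, sub_self, sub_zero, Real.norm_of_nonneg hr0'] at hr
    have h4 := norm_add_le (NormedSpace.exp (r • A) - NormedSpace.exp (r • G a) - r • (A - G a))
      (r • (A - G a))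
    rw [sub_add_cancel, norm_smul, Real.norm_of_nonneg hr0'] at h4
    linarith
  have hstep : ∀ᶠ r : ℝ in 𝓝[≥] 0, ∀ X, N (NormedSpace.exp (r • A) * X) ≤
      Real.exp ((μ + C * δ) * r) * N X := by
    filter_upwards [hsmall, self_mem_nhdsWithin] with r hr hr0 X
    have hr0' : 0 ≤ r := hr0
    have e : NormedSpace.exp (r • A) * X = NormedSpace.exp (r • G a) * X +
        (NormedSpace.exp (r • A) - NormedSpace.exp (r • G a)) * X := by
      rw [sub_mul]
      abel
    have i1 : N ((NormedSpace.exp (r • A) - NormedSpace.exp (r • G a)) * X) ≤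
        C * (δ * r * N X) := by
      refine (hb.modeNorm_le_norm ha _).trans ?_
      gcongr
      refine (norm_mul_le _ _).trans ?_
      gcongr
      exact hb.norm_le_modeNorm ha X
    have i2 : 1 + C * δ * r ≤ Real.exp (C * δ * r) := by
      linarith [Real.add_one_le_exp (C * δ * r)]
    have i3 : 1 ≤ Real.exp (μ * r) := Real.one_le_exp (by positivity)
    have i4 : 0 ≤ C * δ * r := by positivity
    calc N (NormedSpace.exp (r • A) * X) ≤ Real.exp (μ * r) * N X + C * (δ * r * N X) := by
          rw [e]
          exact (hb.modeNorm_add_le ha _ _).trans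
            (add_le_add (hb.modeNorm_flow_le ha hr0' X) i1)
      _ = (Real.exp (μ * r) + C * δ * r) * N X := by ring
      _ ≤ (Real.exp (μ * r) * Real.exp (C * δ * r)) * N X := by
          refine mul_le_mul_of_nonneg_right ?_ (hN0 X)
          nlinarith
      _ = _ := by rw [← Real.exp_add]; ring_nf
  have hlim : Tendsto (fun n : ℕ => h / (n + 1 : ℕ)) atTop (𝓝[≥] 0) := by
    refine tendsto_nhdsWithin_iff.2 ⟨?_, Eventually.of_forall fun n => ?_⟩
    · exact (tendsto_const_div_atTop_nhds_zero_nat h).comp (tendsto_add_atTop_nat 1)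
    · exact div_nonneg hh (by positivity)
  obtain ⟨n, hn⟩ := (hlim.eventually hstep).exists
  set r : ℝ := h / (n + 1 : ℕ)
  have hnr : ((n + 1 : ℕ) : ℝ) * r = h := by
    simp only [r]
    field_simp
  have hiter : ∀ m : ℕ, N (NormedSpace.exp (r • A) ^ m * X) ≤
      Real.exp ((μ + C * δ) * (m * r)) * N X := by
    intro m
    induction m with
    | zero => simp
    | succ m ih =>
      rw [pow_succ', mul_assoc]
      refine (hn _).trans ((mul_le_mul_of_nonneg_left ih (Real.exp_pos _).le).trans_eq ?_)
      rw [← mul_assoc, ← Real.exp_add]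
      push_cast
      ring_nf
  have := hiter (n + 1)
  rwa [← exp_nsmul_smul, hnr] at this

/-- Exponential bounds are stable under small perturbations of the generators. -/
theorem WordBound.perturb (hb : WordBound S G R C μ) (hμ : 0 ≤ μ) {δ : ℝ}
    (hδ : ∀ a ∈ S, ‖G' a - G a‖ < δ) : WordBound S G' R C (μ + C * δ) := by
  have key : ∀ l, IsPositive S l → ∀ a ∈ S, modeNorm S G R μ a (word G' R l) ≤
      C * Real.exp ((μ + C * δ) * duration l) := by
    intro l
    induction l with
    | nil =>
      intro _ a ha
      refine modeNorm_le ha fun A t hA => ?_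
      rw [word_nil, mul_one, duration_nil, mul_zero, Real.exp_zero]
      calc _ ≤ Real.exp (-(μ * t)) * (C * Real.exp (μ * t)) := by
            gcongr
            exact hb.evolution_le hA
        _ = C * Real.exp (-(μ * t) + μ * t) := by rw [Real.exp_add]; ring
        _ = _ := by simp
    | cons p l ih =>
      intro hl a ha
      obtain ⟨⟨hp, hpS⟩, hl'⟩ := isPositive_cons.1 hl
      rw [word_cons, mul_assoc, duration_cons, mul_add, Real.exp_add]
      refine (hb.modeNorm_jump_le hpS ha _).trans
        ((hb.modeNorm_perturbed_flow_le hμ hpS (hδ _ hpS) hp.le _).trans ?_)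
      calc _ ≤ Real.exp ((μ + C * δ) * p.1) * (C * Real.exp ((μ + C * δ) * duration l)) := by
            gcongr
            exact ih hl' _ hpS
        _ = _ := by ring
  intro l hl a ha r hr
  refine (hb.norm_le_modeNorm ha _).trans
    ((hb.modeNorm_perturbed_flow_le hμ ha (hδ a ha) hr _).trans ?_)
  rw [mul_add, Real.exp_add]
  calc _ ≤ Real.exp ((μ + C * δ) * r) * (C * Real.exp ((μ + C * δ) * duration l)) := by
        gcongr
        exact key l hl a ha
    _ = _ := by ring

theorem WordBound.maxLyapunov_le (hb : WordBound S G R C μ) :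
    maxLyapunov S 0 G R ≤ (μ : EReal) :=
  SingPert.maxLyapunov_le fun s t ht => by
    obtain ⟨l, r, a, hl, hr, ha, rfl, hf⟩ := s.exists_flow_eq_word (d := d) ht
    rw [hf]
    exact hb l hl a ha r hr

/-- The exponent controls only times beyond some T. Earlier flows are bounded by the a priori
estimate, and that constant suffices because e^{μt} ≥ 1. -/
theorem WordBound.exists_of_maxLyapunov_lt {M : ℝ} (hb : WordBound S G R C M) (hμ : 0 ≤ μ)
    (h : maxLyapunov S 0 G R < (μ : EReal)) : ∃ C', WordBound S G R C' μ := by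
  obtain ⟨T, hT⟩ := eventually_atTop.1 (eventually_norm_flow_le_of_maxLyapunov_lt h)
  refine ⟨max 1 (|C| * Real.exp (|M| * |T|)), fun l hl a ha r hr => ?_⟩
  have ht : 0 ≤ r + duration l := add_nonneg hr hl.duration_nonneg
  rcases le_or_gt T (r + duration l) with hTt | hTt
  · obtain ⟨s, hs⟩ := Signal.exists_flow_eq_exp_mul_word (d := d) ha hr hl
    rw [← hs]
    exact (hT _ hTt s).trans (le_mul_of_one_le_left (Real.exp_pos _).le (le_max_left _ _))
  · have h1 : Real.exp (M * (r + duration l)) ≤ Real.exp (|M| * |T|) := by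
      refine Real.exp_le_exp.2 (mul_le_mul (le_abs_self M) (hTt.le.trans (le_abs_self T)) ht
        (abs_nonneg M))
    calc _ ≤ C * Real.exp (M * (r + duration l)) := hb l hl a ha r hr
      _ ≤ |C| * Real.exp (|M| * |T|) :=
          mul_le_mul (le_abs_self C) h1 (Real.exp_pos _).le (abs_nonneg C)
      _ ≤ max 1 (|C| * Real.exp (|M| * |T|)) := le_max_right _ _
      _ ≤ _ := le_mul_of_one_le_right (by positivity)
          (Real.one_le_exp (mul_nonneg hμ ht))

end Perturbation

/-! ### From spectral radii to norms of flows -/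

section SpectralBounds

variable {α : Type*} {d : ℕ}

theorem norm_one_le_one : ‖(1 : Mat d)‖ ≤ 1 := by
  rw [← euclOpNorm_eq_norm, euclOpNorm, map_one]
  exact ContinuousLinearMap.norm_id_le

/-- A perturbation of the zero generator: with zero jumps, words with a jump vanish and the
unperturbed system satisfies the bound with C = 1, μ = 0. -/
theorem norm_exp_smul_le {A : Mat d} {b : ℝ} (hA : ‖A‖ < b) {t : ℝ} (ht : 0 ≤ t) :
    ‖NormedSpace.exp (t • A)‖ ≤ Real.exp (b * t) := by
  have h0 : WordBound (Set.univ : Set Unit) (fun _ => (0 : Mat d)) (fun _ => 0) 1 0 := by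
    intro l _ a _ r _
    cases l with
    | nil => simpa using norm_one_le_one
    | cons p l => simp
  have := h0.perturb le_rfl (G' := fun _ => A) (δ := b) (by simpa using hA) []
    (IsPositive.nil _) () trivial t ht
  simpa using this

theorem mem_complexSpectrum_of_smul {M : Mat d} {c : ℝ} (hc : c ≠ 0) {z : ℂ}
    (hz : z ∈ complexSpectrum (c • M)) : (c : ℂ)⁻¹ * z ∈ complexSpectrum M := by
  rw [← hasEigenvalue_complexAction_iff] at hz ⊢
  obtain ⟨x, hx⟩ := hz.exists_hasEigenvector
  refine Module.End.hasEigenvalue_of_hasEigenvector (x := x) ⟨?_, hx.2⟩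
  have h1 : complexAction (c • M) = c • complexAction M := (complexActionLinear d).map_smul c M
  have hc' : (c : ℂ) ≠ 0 := by exact_mod_cast hc
  have h2 := hx.apply_eq_smul
  rw [h1] at h2
  rw [Module.End.mem_eigenspace_iff, mul_smul, ← h2]
  change complexAction M x = (c : ℂ)⁻¹ • (c • complexAction M x)
  rw [← Complex.coe_smul c, smul_smul, inv_mul_cancel₀ hc', one_smul]

theorem norm_le_of_mem_complexSpectrum_smul {M : Mat d} {c B : ℝ} (hc : 0 < c)
    (h : ∀ z ∈ complexSpectrum M, ‖z‖ ≤ B) {z : ℂ} (hz : z ∈ complexSpectrum (c • M)) :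
    ‖z‖ ≤ c * B := by
  have := h _ (mem_complexSpectrum_of_smul hc.ne' hz)
  rwa [norm_mul, norm_inv, Complex.norm_real, Real.norm_of_nonneg hc.le, inv_mul_le_iff₀ hc]
    at this

theorem eq_one_of_mem_complexSpectrum_one {z : ℂ} (hz : z ∈ complexSpectrum (1 : Mat d)) :
    z = 1 := by
  rw [← hasEigenvalue_complexAction_iff, complexAction_one] at hz
  obtain ⟨x, hx⟩ := hz.exists_hasEigenvector
  have h1 : x = z • x := hx.apply_eq_smul
  have h2 : (1 : ℂ) • x = z • x := by rwa [one_smul]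
  exact (smul_left_injective ℂ hx.2 h2).symm

theorem norm_le_pow_of_mem_complexSpectrum_pow {M : Mat d} {B : ℝ}
    (h : ∀ z ∈ complexSpectrum M, ‖z‖ ≤ B) (n : ℕ) {z : ℂ}
    (hz : z ∈ complexSpectrum (M ^ n)) : ‖z‖ ≤ B ^ n := by
  rcases n.eq_zero_or_pos with rfl | hn
  · rw [pow_zero] at hz
    simp [eq_one_of_mem_complexSpectrum_one hz]
  · have hmap : (M ^ n).map (fun r : ℝ => (r : ℂ)) = M.map (fun r : ℝ => (r : ℂ)) ^ n :=
      map_pow (Complex.ofRealHom.mapMatrix : Mat d →+* Matrix (Fin d) (Fin d) ℂ) M n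
    rw [complexSpectrum, hmap, spectrum.map_pow_of_pos _ hn] at hz
    obtain ⟨w, hw, rfl⟩ := hz
    rw [norm_pow]
    exact pow_le_pow_left₀ (norm_nonneg w) (h w hw) n

theorem exists_norm_pow_lt_one {M : Mat d} {q : ℝ} (hq0 : 0 ≤ q) (hq : q < 1)
    (h : ∀ z ∈ complexSpectrum M, ‖z‖ ≤ q) : ∃ n : ℕ, 0 < n ∧ ‖M ^ n‖ < 1 := by
  obtain ⟨C, r, -, hr0, hr1, hC⟩ := exists_norm_list_prod_le (F := {M}) (B := ‖M‖) (by simp)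
    hq0 hq (by
      intro L hL z hz
      rw [List.eq_replicate_of_mem (a := M) (fun N hN => hL N hN), List.prod_replicate] at hz
      exact norm_le_pow_of_mem_complexSpectrum_pow h _ hz)
  have hlim : Tendsto (fun n : ℕ => C * r ^ n) atTop (𝓝 (C * 0)) :=
    (tendsto_pow_atTop_nhds_zero_of_lt_one hr0 hr1).const_mul C
  rw [mul_zero] at hlim
  obtain ⟨n, hn, hn0⟩ := ((hlim.eventually_lt_const one_pos).and (eventually_gt_atTop 0)).exists
  refine ⟨n, hn0, lt_of_le_of_lt ?_ hn⟩
  have := hC (List.replicate n M) (fun N hN => List.eq_of_mem_replicate hN)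
  rwa [List.prod_replicate, List.length_replicate] at this

/-- On a compact family of generators, the exponentials are uniformly bounded. -/
theorem exists_norm_exp_smul_le [TopologicalSpace α] {S : Set α} (hS : IsCompact S)
    {G : α → Mat d} (hG : ContinuousOn G S) {μ ν : ℝ} (hμν : μ < ν)
    (h : ∀ a ∈ S, ∀ z ∈ complexSpectrum (NormedSpace.exp (G a)), ‖z‖ ≤ Real.exp μ) :
    ∃ C, ∀ a ∈ S, ∀ t : ℝ, 0 ≤ t → ‖NormedSpace.exp (t • G a)‖ ≤ C * Real.exp (ν * t) := by
  refine hS.induction_on (p := fun T => ∃ C, ∀ a ∈ T, ∀ t : ℝ, 0 ≤ t →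
    ‖NormedSpace.exp (t • G a)‖ ≤ C * Real.exp (ν * t)) ⟨0, by simp⟩ ?_ ?_ ?_
  · rintro T T' hT ⟨C, hC⟩
    exact ⟨C, fun a ha => hC a (hT ha)⟩
  · rintro T T' ⟨C, hC⟩ ⟨D, hD⟩
    refine ⟨max C D, fun a ha t ht => ?_⟩
    rcases ha with ha | ha
    · exact (hC a ha t ht).trans (by gcongr; exact le_max_left _ _)
    · exact (hD a ha t ht).trans (by gcongr; exact le_max_right _ _)
  · intro a ha
    -- The normalised exponential has spectral radius below 1, so some power has norm below 1. The
    -- same n works near a; dividing t by n bounds all times there, and compactness does the rest.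
    obtain ⟨n, hn, hna⟩ := exists_norm_pow_lt_one (M := Real.exp (-ν) • NormedSpace.exp (G a))
      (q := Real.exp (-ν) * Real.exp μ) (by positivity)
      (by rw [← Real.exp_add]; exact Real.exp_lt_one_iff.2 (by linarith))
      (fun z hz => norm_le_of_mem_complexSpectrum_smul (Real.exp_pos _) (h a ha) hz)
    have hn' : (0 : ℝ) < n := by exact_mod_cast hn
    have hna' : ‖NormedSpace.exp ((n : ℝ) • G a)‖ < Real.exp (ν * n) := by
      rw [smul_pow, norm_smul, norm_pow, Real.norm_of_nonneg (Real.exp_pos _).le,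
        ← Real.exp_nat_mul] at hna
      have e := exp_nsmul_smul n 1 (G a)
      rw [mul_one, one_smul] at e
      rw [e]
      have := (lt_div_iff₀' (Real.exp_pos _)).2 hna
      rwa [one_div, ← Real.exp_neg, mul_neg, neg_neg, mul_comm (n : ℝ)] at this
    set b : ℝ := ‖G a‖ + 1
    have hcont := hG a ha
    have ev1 : ∀ᶠ a' in 𝓝[S] a, ‖NormedSpace.exp ((n : ℝ) • G a')‖ < Real.exp (ν * n) :=
      ((continuous_matrix_exp.tendsto _).comp (hcont.const_smul (n : ℝ))).norm.eventually_lt_const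
        hna'
    have ev2 : ∀ᶠ a' in 𝓝[S] a, ‖G a'‖ < b :=
      hcont.norm.eventually_lt_const (by simp [b])
    refine ⟨_, ev1.and ev2, Real.exp (b * n + |ν| * n), ?_⟩
    rintro a' ⟨h1, h2⟩ t ht
    set k : ℕ := ⌊t / n⌋₊
    set s : ℝ := t - k * n
    have hk1 : (k : ℝ) * n ≤ t := (le_div_iff₀ hn').1 (Nat.floor_le (by positivity))
    have hk2 : t < (k + 1) * n := (div_lt_iff₀ hn').1 (Nat.lt_floor_add_one _)
    have hs0 : 0 ≤ s := sub_nonneg.2 hk1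
    have hsn : s ≤ n := by simp only [s]; linarith
    have hb0 : 0 ≤ b := by positivity
    have e : t = k * n + s := by simp only [s]; ring
    have hνs : 0 ≤ |ν| * n + ν * s := by
      have i1 := mul_le_mul_of_nonneg_left hsn (abs_nonneg ν)
      have i2 := mul_le_mul_of_nonneg_right (neg_abs_le ν) hs0
      linarith
    calc ‖NormedSpace.exp (t • G a')‖
        = ‖NormedSpace.exp ((n : ℝ) • G a') ^ k * NormedSpace.exp (s • G a')‖ := by
          conv_lhs => rw [e]
          rw [exp_add_smul, exp_nsmul_smul]
      _ ≤ Real.exp (ν * n) ^ k * Real.exp (b * s) := by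
          refine (norm_mul_le _ _).trans ?_
          gcongr
          · rcases k.eq_zero_or_pos with hk | hk
            · rw [hk, pow_zero, pow_zero]
              exact norm_one_le_one
            · exact (norm_pow_le' _ hk).trans (by gcongr)
          · exact norm_exp_smul_le h2 hs0
      _ ≤ Real.exp (b * n + |ν| * n) * Real.exp (ν * t) := by
          rw [← Real.exp_nat_mul, ← Real.exp_add, ← Real.exp_add]
          refine Real.exp_le_exp.2 ?_
          have := mul_le_mul_of_nonneg_left hsn hb0
          rw [e, mul_add]
          linarith

variable {S : Set α} {G R : α → Mat d}

/-- If the spectral radii of all words of positive duration are at most exponential, so are the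
norms of all flows. -/
theorem WordBound.exists_of_spectrum {C₀ M₀ : ℝ} (hb : WordBound S G R C₀ M₀) {B₁ : ℝ}
    (hR : ∀ a ∈ S, ‖R a‖ ≤ B₁) {μ ν : ℝ} (hν : 0 ≤ ν) (hμν : μ < ν) {C₁ : ℝ}
    (hexp : ∀ a ∈ S, ∀ t : ℝ, 0 ≤ t → ‖NormedSpace.exp (t • G a)‖ ≤ C₁ * Real.exp (ν * t))
    (hspec : ∀ l, IsPositive S l → ∀ z ∈ complexSpectrum (word G R l),
      ‖z‖ ≤ Real.exp (μ * duration l)) : ∃ C, WordBound S G R C ν := by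
  rcases S.eq_empty_or_nonempty with rfl | ⟨a₀, ha₀⟩
  · exact ⟨0, fun l _ a ha => absurd ha (Set.notMem_empty a)⟩
  have hC₁ : 0 ≤ C₁ := by
    have := (norm_nonneg _).trans (hexp a₀ ha₀ 0 le_rfl)
    simpa using this
  have hB₁ : 0 ≤ B₁ := (norm_nonneg _).trans (hR a₀ ha₀)
  let W : List (ℝ × α) → Mat d := fun l => Real.exp (-(ν * duration l)) • word G R l
  have hWapp : ∀ l l', W (l ++ l') = W l * W l' := by
    intro l l'
    simp only [W, word_append, duration_append, smul_mul_smul_comm, ← Real.exp_add]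
    congr 2
    ring
  set C₄ : ℝ := |C₀| * Real.exp |M₀| with hC₄def
  have hC₄ : 0 ≤ C₄ := by positivity
  have hshort : ∀ l, IsPositive S l → duration l ≤ 1 → ‖W l‖ ≤ C₄ := by
    intro l hl hl1
    have h0 := hl.duration_nonneg
    have h1 := hb l hl a₀ ha₀ 0 le_rfl
    rw [zero_smul, NormedSpace.exp_zero, one_mul, zero_add] at h1
    simp only [W]
    rw [norm_smul, Real.norm_of_nonneg (Real.exp_pos _).le]
    have h2 : Real.exp (-(ν * duration l)) ≤ 1 :=
      Real.exp_le_one_iff.2 (neg_nonpos.2 (mul_nonneg hν h0))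
    refine (mul_le_of_le_one_left (norm_nonneg _) h2).trans (h1.trans ?_)
    refine mul_le_mul (le_abs_self _) (Real.exp_le_exp.2 ?_) (Real.exp_pos _).le (abs_nonneg _)
    have i1 := mul_le_mul_of_nonneg_right (le_abs_self M₀) h0
    have i2 := mul_le_mul_of_nonneg_left hl1 (abs_nonneg M₀)
    linarith
  have hpiece : ∀ p : ℝ × α, 0 < p.1 ∧ p.2 ∈ S → ‖W [p]‖ ≤ B₁ * C₁ := by
    rintro p ⟨hp, hpS⟩
    simp only [W, word_cons, word_nil, mul_one, duration_cons, duration_nil, add_zero]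
    rw [norm_smul, Real.norm_of_nonneg (Real.exp_pos _).le]
    calc _ ≤ Real.exp (-(ν * p.1)) * (B₁ * (C₁ * Real.exp (ν * p.1))) := by
          gcongr
          refine (norm_mul_le _ _).trans ?_
          gcongr
          exacts [hR _ hpS, hexp _ hpS _ hp.le]
      _ = (Real.exp (-(ν * p.1)) * Real.exp (ν * p.1)) * (B₁ * C₁) := by ring
      _ = _ := by rw [← Real.exp_add]; simp
  -- The Berger–Wang family: blocks of duration at least 1, so that n of them last at least n and
  -- their normalised eigenvalues are at most e^{-(ν−μ)n}.
  let F : Set (Mat d) := {M | ∃ l, IsPositive S l ∧ 1 ≤ duration l ∧ W l = M ∧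
    ‖M‖ ≤ B₁ * C₁ * C₄}
  have hFprod : ∀ L : List (Mat d), (∀ M ∈ L, M ∈ F) → ∃ l, IsPositive S l ∧
      (L.length : ℝ) ≤ duration l ∧ W l = L.prod := by
    intro L
    induction L with
    | nil => exact fun _ => ⟨[], IsPositive.nil S, by simp, by simp [W]⟩
    | cons M L ih =>
      intro hL
      obtain ⟨l, h1, h2, h3⟩ := ih fun N hN => hL N (by simp [hN])
      obtain ⟨l', h1', h2', h3', -⟩ := hL M (by simp)
      refine ⟨l' ++ l, isPositive_append.2 ⟨h1', h1⟩, ?_, ?_⟩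
      · rw [duration_append, List.length_cons]
        push_cast
        linarith
      · rw [hWapp, h3, h3', List.prod_cons]
  obtain ⟨C, r, hC, hr0, hr1, hCr⟩ := exists_norm_list_prod_le (F := F) (B := B₁ * C₁ * C₄)
    (by rintro M ⟨_, _, _, _, h⟩; exact h) (q := Real.exp (-(ν - μ))) (Real.exp_pos _).le
    (Real.exp_lt_one_iff.2 (by linarith)) (by
      intro L hL z hz
      obtain ⟨l, h1, h2, h3⟩ := hFprod L hL
      rw [← h3] at hz
      refine (norm_le_of_mem_complexSpectrum_smul (Real.exp_pos _) (hspec l h1) hz).trans ?_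
      rw [← Real.exp_add, ← Real.exp_nat_mul]
      refine Real.exp_le_exp.2 ?_
      nlinarith)
  -- Close a block as soon as its duration reaches 1. It is then one piece, perhaps very long but
  -- bounded by `hexp`, after a word shorter than 1, bounded a priori; hence all blocks are
  -- uniformly bounded.
  have hdecomp : ∀ l, IsPositive S l → ∃ l₀ L, IsPositive S l₀ ∧ duration l₀ < 1 ∧
      (∀ M ∈ L, M ∈ F) ∧ W l = W l₀ * List.prod L := by
    intro l
    induction l with
    | nil => exact fun _ => ⟨[], [], IsPositive.nil S, by simp, by simp, by simp [W]⟩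
    | cons p l ih =>
      intro hl
      obtain ⟨hp, hl'⟩ := isPositive_cons.1 hl
      obtain ⟨l₀, L, h1, h2, h3, h4⟩ := ih hl'
      have hpos : IsPositive S (p :: l₀) := isPositive_cons.2 ⟨hp, h1⟩
      have e1 : W (p :: l) = W (p :: l₀) * List.prod L := by
        rw [← List.singleton_append, hWapp, h4, ← mul_assoc, ← hWapp, List.singleton_append]
      rcases lt_or_ge (duration (p :: l₀)) 1 with hlt | hge
      · exact ⟨p :: l₀, L, hpos, hlt, h3, e1⟩
      · refine ⟨[], W (p :: l₀) :: L, IsPositive.nil S, by simp, ?_, ?_⟩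
        · intro M hM
          rcases List.mem_cons.1 hM with rfl | hM
          · refine ⟨p :: l₀, hpos, hge, rfl, ?_⟩
            rw [← List.singleton_append, hWapp]
            refine (norm_mul_le _ _).trans ?_
            gcongr
            exacts [hpiece p hp, hshort l₀ h1 h2.le]
          · exact h3 M hM
        · rw [List.prod_cons, e1]
          simp [W]
  refine ⟨C₁ * (C₄ * C), fun l hl a ha t ht => ?_⟩
  obtain ⟨l₀, L, h1, h2, h3, h4⟩ := hdecomp l hl
  have hW : ‖W l‖ ≤ C₄ * C := by
    rw [h4]
    refine (norm_mul_le _ _).trans ?_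
    gcongr
    · exact hshort l₀ h1 h2.le
    · exact (hCr L h3).trans (mul_le_of_le_one_right hC (pow_le_one₀ hr0 hr1.le))
  have hword : ‖word G R l‖ = Real.exp (ν * duration l) * ‖W l‖ := by
    simp only [W]
    rw [norm_smul, Real.norm_of_nonneg (Real.exp_pos _).le, ← mul_assoc, ← Real.exp_add]
    simp
  calc _ ≤ (C₁ * Real.exp (ν * t)) * (Real.exp (ν * duration l) * (C₄ * C)) := by
        refine (norm_mul_le _ _).trans ?_
        rw [hword]
        gcongr
        exact hexp a ha t ht
    _ = C₁ * (C₄ * C) * Real.exp (ν * (t + duration l)) := by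
        rw [mul_add, Real.exp_add]
        ring

end SpectralBounds

/-! ### Relabelling of modes -/

section Image

variable {α β : Type*} {d : ℕ}

theorem word_map (f : α → β) (G R : β → Mat d) (l : List (ℝ × α)) :
    word G R (l.map (Prod.map id f)) = word (fun a => G (f a)) (fun a => R (f a)) l := by
  simp [word, Function.comp_def]

theorem duration_map (f : α → β) (l : List (ℝ × α)) :
    duration (l.map (Prod.map id f)) = duration l := by
  simp [duration, Function.comp_def]

theorem wordBound_image_iff (f : α → β) {S : Set α} {G R : β → Mat d} {C μ : ℝ} :
    WordBound (f '' S) G R C μ ↔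
      WordBound S (fun a => G (f a)) (fun a => R (f a)) C μ := by
  constructor
  · intro h l hl a ha r hr
    have := h (l.map (Prod.map id f)) (fun p hp => by
      obtain ⟨p', hp', rfl⟩ := List.mem_map.1 hp
      exact ⟨(hl p' hp').1, _, (hl p' hp').2, rfl⟩) (f a) ⟨a, ha, rfl⟩ r hr
    rwa [word_map, duration_map] at this
  · rintro h l hl _ ⟨a, ha, rfl⟩ r hr
    obtain ⟨l', hl', rfl⟩ : ∃ l', IsPositive S l' ∧ l'.map (Prod.map id f) = l := by
      induction l with
      | nil => exact ⟨[], IsPositive.nil S, rfl⟩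
      | cons p l ih =>
        obtain ⟨⟨hp, a', ha', hpa⟩, hl⟩ := isPositive_cons.1 hl
        obtain ⟨l', h1, h2⟩ := ih hl
        exact ⟨(p.1, a') :: l', isPositive_cons.2 ⟨⟨hp, ha'⟩, h1⟩, by simp [h2, hpa]⟩
    rw [word_map, duration_map]
    exact h l' hl' a ha r hr

end Image

/-! ### The singularly perturbed system in fast time -/

section Modes

variable {d : ℕ}

/-- The matrix `P⁻¹ E_ℓ^0 Λ`. -/
def slowGenerator (σ : Mode d) : Mat d := (σ.P)⁻¹ * slowFast d σ.ell 0 * σ.Lam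

/-- The diagonal matrix ε (E_ℓ^ε)⁻¹ has entries ε on the first ℓ lines and 1 elsewhere. -/
theorem smul_singGenerator {ε : ℝ} (hε : 0 < ε) (σ : Mode d) :
    ε • singGenerator ε σ = fastGenerator σ + ε • slowGenerator σ := by
  have hinv : (slowFast d σ.ell ε)⁻¹ =
      Matrix.diagonal fun i : Fin d => if (i : ℕ) < σ.ell then 1 else ε⁻¹ := by
    refine Matrix.inv_eq_right_inv ?_
    rw [slowFast, Matrix.diagonal_mul_diagonal, ← Matrix.diagonal_one]
    congr 1
    funext i
    split_ifs
    · simp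
    · exact mul_inv_cancel₀ hε.ne'
  have hsum : ε • (slowFast d σ.ell ε)⁻¹ =
      slowFastCompl d σ.ell 0 + ε • slowFast d σ.ell 0 := by
    rw [hinv, slowFastCompl, slowFast, ← Matrix.diagonal_smul, ← Matrix.diagonal_smul,
      Matrix.diagonal_add]
    congr 1
    funext i
    simp only [Pi.smul_apply, smul_eq_mul]
    split_ifs
    · simp
    · simp [hε.ne']
  rw [singGenerator, Matrix.mul_inv_rev, fastGenerator, slowGenerator, ← Matrix.smul_mul,
    ← Matrix.mul_smul, hsum, Matrix.mul_add, Matrix.add_mul, Matrix.mul_smul, Matrix.smul_mul]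

theorem continuous_inv_P : Continuous fun σ : Mode d => (σ.P)⁻¹ := by
  simp only [Mode.P, ← Matrix.coe_units_inv]
  exact Units.continuous_val.comp (continuous_inv.comp (continuous_fst.comp continuous_snd))

theorem continuous_Lam : Continuous (Mode.Lam : Mode d → Mat d) :=
  continuous_fst.comp (continuous_snd.comp continuous_snd)

theorem continuous_R : Continuous (Mode.R : Mode d → Mat d) :=
  continuous_snd.comp (continuous_snd.comp continuous_snd)

theorem continuous_comp_ell (f : ℕ → Mat d) : Continuous fun σ : Mode d => f σ.ell :=
  (continuous_of_discreteTopology (f := fun k : Set.Icc 1 (d - 1) => f k)).comp continuous_fst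

theorem continuous_fastGenerator : Continuous (fastGenerator : Mode d → Mat d) :=
  (continuous_inv_P.mul (continuous_comp_ell fun ℓ => slowFastCompl d ℓ 0)).mul continuous_Lam

theorem continuous_slowGenerator : Continuous (slowGenerator : Mode d → Mat d) :=
  (continuous_inv_P.mul (continuous_comp_ell fun ℓ => slowFast d ℓ 0)).mul continuous_Lam

theorem _root_.IsCompact.exists_norm_mode_le {K : Set (Mode d)} (hK : IsCompact K)
    {f : Mode d → Mat d} (hf : Continuous f) : ∃ B, 0 < B ∧ ∀ σ ∈ K, ‖f σ‖ ≤ B := by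
  obtain ⟨B, hB⟩ := hK.exists_bound_of_continuousOn hf.continuousOn
  exact ⟨max B 1, by positivity, fun σ hσ => (hB σ hσ).trans (le_max_left _ _)⟩

theorem tendsto_smul_singGenerator (σ : Mode d) :
    Tendsto (fun ε : ℝ => ε • singGenerator ε σ) (𝓝[>] 0) (𝓝 (fastGenerator σ)) := by
  have hc : Continuous fun ε : ℝ => fastGenerator σ + ε • slowGenerator σ := by fun_prop
  have h := (hc.tendsto 0).mono_left (nhdsWithin_le_nhds (s := Set.Ioi 0))
  rw [zero_smul, add_zero] at h
  refine h.congr' ?_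
  filter_upwards [self_mem_nhdsWithin] with ε hε
  exact (smul_singGenerator hε σ).symm

theorem tendsto_exp_smul_singGenerator (σ : Mode d) (t : ℝ) :
    Tendsto (fun ε : ℝ => NormedSpace.exp (t • ε • singGenerator ε σ)) (𝓝[>] 0)
      (𝓝 (NormedSpace.exp (t • fastGenerator σ))) :=
  (continuous_matrix_exp.tendsto _).comp ((tendsto_smul_singGenerator σ).const_smul t)

theorem tendsto_word_smul_singGenerator (l : List (ℝ × Mode d)) :
    Tendsto (fun ε : ℝ => word (fun σ => ε • singGenerator ε σ) Mode.R l) (𝓝[>] 0)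
      (𝓝 (word fastGenerator Mode.R l)) := by
  induction l with
  | nil => exact tendsto_const_nhds
  | cons p l ih =>
    simp only [word_cons]
    exact (tendsto_const_nhds.mul (tendsto_exp_smul_singGenerator p.2 p.1)).mul ih

theorem le_mul_of_div_le {ε b : ℝ} (hε : 0 < ε) {x : EReal} (h : ((b / ε : ℝ) : EReal) ≤ x) :
    (b : EReal) ≤ (ε : EReal) * x := by
  calc (b : EReal) = (ε : EReal) * ((b / ε : ℝ) : EReal) := by
        rw [← EReal.coe_mul, mul_div_cancel₀ _ hε.ne']
    _ ≤ _ := mul_le_mul_of_nonneg_left h (by exact_mod_cast hε.le)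

theorem mul_le_of_le_div {ε b : ℝ} (hε : 0 < ε) {x : EReal} (h : x ≤ ((b / ε : ℝ) : EReal)) :
    (ε : EReal) * x ≤ (b : EReal) := by
  calc _ ≤ (ε : EReal) * ((b / ε : ℝ) : EReal) :=
        mul_le_mul_of_nonneg_left h (by exact_mod_cast hε.le)
    _ = (b : EReal) := by rw [← EReal.coe_mul, mul_div_cancel₀ _ hε.ne']

variable {K : Set (Mode d)}

/-- Eigenvalues of the limit of period maps bound the Lyapunov exponent from below. -/
theorem eventually_le_mul_lyapunovSigma {M : ℝ → Mat d} {M₀ : Mat d}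
    (hM : Tendsto M (𝓝[>] 0) (𝓝 M₀)) {T : ℝ} (hT : 0 < T)
    (hflow : ∀ ε > 0, ∀ n : ℕ, ∃ s : Signal K 0,
      s.flow (singGenerator ε) Mode.R (ε * (n * T)) = M ε ^ n)
    {z : ℂ} (hz : z ∈ complexSpectrum M₀) {b : ℝ} (hb : Real.exp (b * T) < ‖z‖) :
    ∀ᶠ ε : ℝ in 𝓝[>] 0, (b : EReal) ≤ (ε : EReal) * lyapunovSigma K 0 ε := by
  obtain ⟨c, hc, hpow⟩ := exists_norm_pow_le_of_mem_complexSpectrum d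
  filter_upwards [eventually_exists_mem_complexSpectrum hM hz (sub_pos.2 hb),
    self_mem_nhdsWithin] with ε hw hε
  have hε' : 0 < ε := hε
  obtain ⟨w, hw, hzw⟩ := hw
  have hbw : Real.exp (b * T) < ‖w‖ := by
    have := norm_sub_norm_le z w
    linarith
  -- After n periods the norm is at least |w|^n / c, which exceeds e^{bnT} for large n; the time
  -- elapsed is εnT, whence the rate b/ε.
  refine le_mul_of_div_le hε' (le_maxLyapunov (frequently_atTop.2 fun t₀ => ?_))
  have h1 : Tendsto (fun n : ℕ => (‖w‖ / Real.exp (b * T)) ^ n) atTop atTop :=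
    tendsto_pow_atTop_atTop_of_one_lt ((one_lt_div (Real.exp_pos _)).2 hbw)
  have h2 : Tendsto (fun n : ℕ => ε * (n * T)) atTop atTop :=
    (tendsto_natCast_atTop_atTop.atTop_mul_const hT).const_mul_atTop hε'
  obtain ⟨n, hn1, hn2⟩ := ((h1.eventually_gt_atTop c).and (h2.eventually_ge_atTop t₀)).exists
  obtain ⟨s, hs⟩ := hflow ε hε' n
  refine ⟨ε * (n * T), hn2, s, ?_⟩
  rw [hs]
  have e : b / ε * (ε * (n * T)) = n * (b * T) := by field_simp
  rw [e, Real.exp_nat_mul]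
  rw [div_pow, lt_div_iff₀ (by positivity)] at hn1
  exact lt_of_mul_lt_mul_left (hn1.trans_le (hpow _ _ hw n)) hc.le

/-- Not a case of the estimate for words: a word ends with a jump, which may destroy the growth of a
mode that is never left. -/
theorem eventually_le_mul_lyapunovSigma_of_mode {σ : Mode d} (hσ : σ ∈ K) {z : ℂ}
    (hz : z ∈ complexSpectrum (NormedSpace.exp (fastGenerator σ))) {b : ℝ}
    (hb : Real.exp b < ‖z‖) :
    ∀ᶠ ε : ℝ in 𝓝[>] 0, (b : EReal) ≤ (ε : EReal) * lyapunovSigma K 0 ε := by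
  refine eventually_le_mul_lyapunovSigma (M := fun ε => NormedSpace.exp (ε • singGenerator ε σ))
    ?_ one_pos (fun ε hε n => ⟨Signal.const hσ, ?_⟩) hz (by rwa [mul_one])
  · simpa using tendsto_exp_smul_singGenerator σ 1
  · rw [Signal.flow_const _ _ _ (by positivity), mul_one, mul_comm, exp_nsmul_smul]

theorem eventually_le_mul_lyapunovSigma_of_word (hne : K.Nonempty) {l : List (ℝ × Mode d)}
    (hl : IsPositive K l) (hl0 : l ≠ []) {z : ℂ}
    (hz : z ∈ complexSpectrum (word fastGenerator Mode.R l)) {b : ℝ}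
    (hb : Real.exp (b * duration l) < ‖z‖) :
    ∀ᶠ ε : ℝ in 𝓝[>] 0, (b : EReal) ≤ (ε : EReal) * lyapunovSigma K 0 ε := by
  obtain ⟨σ, hσ⟩ := hne
  refine eventually_le_mul_lyapunovSigma (tendsto_word_smul_singGenerator l)
    (hl.duration_pos hl0) (fun ε hε n => ?_) hz hb
  obtain ⟨l', h1, h2, h3⟩ := exists_word_eq_pow (d := d) hl n
  obtain ⟨s, hs⟩ := Signal.exists_flow_eq_exp_mul_word (d := d) hσ le_rfl (h1.scale hε)
  refine ⟨s, ?_⟩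
  have := hs (singGenerator ε) Mode.R
  rw [zero_add, duration_scale, h2, zero_smul, NormedSpace.exp_zero, one_mul,
    word_scale (fun _ => rfl), h3] at this
  exact this

theorem spectralAbscissa_le_liminf {σ : Mode d} (hσ : σ ∈ K) :
    spectralAbscissa (fastGenerator σ) ≤
      liminf (fun ε : ℝ => (ε : EReal) * lyapunovSigma K 0 ε) (𝓝[>] 0) := by
  rw [spectralAbscissa_eq]
  refine iSup₂_le fun z hz => EReal.ge_of_forall_gt_iff_ge.1 fun b hb => ?_
  refine le_liminf_of_le (h := ?_)
  refine eventually_le_mul_lyapunovSigma_of_mode hσ (exp_mem_complexSpectrum hz) ?_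
  rw [Complex.norm_exp]
  exact Real.exp_lt_exp.2 (by exact_mod_cast hb)

/-- As ℓ ≥ 1, the first diagonal entry of E_{ℓᶜ}^0 vanishes; the matrix is singular and 0 is an
eigenvalue. -/
theorem spectralAbscissa_fastGenerator_nonneg (hd : 2 ≤ d) (σ : Mode d) :
    0 ≤ spectralAbscissa (fastGenerator σ) := by
  have hdet : (fastGenerator σ).det = 0 := by
    have h0 : (slowFastCompl d σ.ell 0).det = 0 := by
      rw [slowFastCompl, Matrix.det_diagonal]
      refine Finset.prod_eq_zero (Finset.mem_univ (⟨0, by omega⟩ : Fin d)) ?_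
      rw [if_pos]
      exact σ.1.2.1
    rw [fastGenerator, Matrix.det_mul, Matrix.det_mul, h0]
    simp
  have hmem : (0 : ℂ) ∈ complexSpectrum (fastGenerator σ) := by
    rw [complexSpectrum, spectrum.zero_mem_iff, Matrix.isUnit_iff_isUnit_det,
      isUnit_iff_ne_zero, not_not]
    have := (Complex.ofRealHom.map_det (fastGenerator σ)).symm
    rw [hdet, map_zero] at this
    exact this
  rw [spectralAbscissa_eq]
  exact le_iSup₂_of_le 0 hmem (by simp)

/-- With zero generators a flow is just a product of jumps, so boundedness of the jumps is a bound
of rate 0. Perturbing from zero generators then gives an exponential bound for any bounded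
generators. -/
theorem DiscreteBounded.exists_wordBound (h : DiscreteBounded (Mode.R '' K)) :
    ∃ C, 0 < C ∧ WordBound K (fun _ => 0) Mode.R C 0 := by
  obtain ⟨C, hC0, hC⟩ := h
  refine ⟨max C 1, by positivity, fun l hl σ hσ r hr => ?_⟩
  have hw : word (fun _ => 0) Mode.R l = (l.map fun p => p.2.R).prod := by simp [word]
  rw [smul_zero, NormedSpace.exp_zero, one_mul, hw, zero_mul, Real.exp_zero, mul_one]
  rcases eq_or_ne l [] with rfl | hl0
  · exact norm_one_le_one.trans (le_max_right _ _)
  · refine (hC _ (by simpa using hl0) fun M hM => ?_).trans (le_max_left _ _)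
    obtain ⟨p, hp, rfl⟩ := List.mem_map.1 hM
    exact ⟨p.2, (hl p hp).2, rfl⟩

theorem DiscreteBounded.exists_wordBound_fastGenerator (hK : IsCompact K)
    (h : DiscreteBounded (Mode.R '' K)) :
    ∃ C M, WordBound K fastGenerator Mode.R C M := by
  obtain ⟨C, hC, hb⟩ := h.exists_wordBound
  obtain ⟨B, hB, hB'⟩ := hK.exists_norm_mode_le continuous_fastGenerator
  exact ⟨_, _, hb.perturb le_rfl (G' := fastGenerator) (δ := B + 1) fun σ hσ => by
    rw [sub_zero]
    linarith [hB' σ hσ]⟩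

theorem wordBound_fastModes_iff {C μ : ℝ} :
    WordBound (fastModes K) Prod.fst Prod.snd C μ ↔ WordBound K fastGenerator Mode.R C μ :=
  wordBound_image_iff fun σ : Mode d => (fastGenerator σ, σ.R)

/-- The change of time t = ε s: durations are divided by ε, the generators multiplied by ε. -/
theorem maxLyapunov_singGenerator_le {ε : ℝ} (hε : 0 < ε) {C μ : ℝ}
    (hb : WordBound K (fun σ => ε • singGenerator ε σ) Mode.R C μ) :
    (ε : EReal) * lyapunovSigma K 0 ε ≤ (μ : EReal) := by
  refine mul_le_of_le_div hε (WordBound.maxLyapunov_le (C := C) fun l hl σ hσ r hr => ?_)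
  have := hb (scale ε⁻¹ l) (hl.scale (inv_pos.2 hε)) σ hσ (ε⁻¹ * r) (by positivity)
  rw [word_scale (G' := singGenerator ε) (fun σ => by
    rw [smul_smul, inv_mul_cancel₀ hε.ne', one_smul]), duration_scale, smul_smul] at this
  have e1 : ε⁻¹ * r * ε = r := by field_simp
  have e2 : μ * (ε⁻¹ * r + ε⁻¹ * duration l) = μ / ε * (r + duration l) := by field_simp
  rwa [e1, e2] at this

/-- The limit system has a bound of rate some μ below b, with a constant independent of ε; the
perturbation ε `slowGenerator` raises the rate by O(ε). -/
theorem eventually_mul_lyapunovSigma_lt (hK : IsCompact K)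
    (h : DiscreteBounded (Mode.R '' K)) {b : EReal}
    (hb : max 0 (lyapunovDelta (fastModes K) 0) < b) :
    ∀ᶠ ε : ℝ in 𝓝[>] 0, (ε : EReal) * lyapunovSigma K 0 ε < b := by
  obtain ⟨ν, hν1, hν2⟩ := EReal.lt_iff_exists_real_btwn.1 hb
  obtain ⟨μ, hμ1, hμ2⟩ := EReal.lt_iff_exists_real_btwn.1 hν1
  have hμν : μ < ν := by exact_mod_cast hμ2
  have hμ0 : 0 < μ := by exact_mod_cast (le_max_left _ _).trans_lt hμ1
  obtain ⟨C, M, hbM⟩ := h.exists_wordBound_fastGenerator hK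
  have hZ : WordBound (fastModes K) Prod.fst Prod.snd C M := wordBound_fastModes_iff.2 hbM
  have hlt : maxLyapunov (fastModes K) 0 Prod.fst Prod.snd < (μ : EReal) :=
    (le_max_right _ _).trans_lt hμ1
  obtain ⟨C', hbμ⟩ := hZ.exists_of_maxLyapunov_lt hμ0.le hlt
  have hbμ' : WordBound K fastGenerator Mode.R C' μ := wordBound_fastModes_iff.1 hbμ
  obtain ⟨B, hB, hB'⟩ := hK.exists_norm_mode_le continuous_slowGenerator
  have hlim : Tendsto (fun ε : ℝ => μ + C' * (ε * (B + 1))) (𝓝[>] 0) (𝓝 μ) := by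
    have hc : Continuous fun ε : ℝ => μ + C' * (ε * (B + 1)) := by fun_prop
    simpa using (hc.tendsto 0).mono_left (nhdsWithin_le_nhds (s := Set.Ioi 0))
  filter_upwards [hlim.eventually_lt_const hμν, self_mem_nhdsWithin] with ε hε1 hε
  have hε' : 0 < ε := hε
  have hbε : WordBound K (fun σ => ε • singGenerator ε σ) Mode.R C' (μ + C' * (ε * (B + 1))) := by
    refine hbμ'.perturb hμ0.le fun σ hσ => ?_
    rw [smul_singGenerator hε', add_sub_cancel_left, norm_smul, Real.norm_of_nonneg hε'.le]
    exact mul_lt_mul_of_pos_left (by linarith [hB' σ hσ]) hε'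
  exact (maxLyapunov_singGenerator_le hε' hbε).trans_lt ((EReal.coe_lt_coe_iff.2 hε1).trans hν2)

theorem eventually_lt_mul_lyapunovSigma (hK : IsCompact K) (hne : K.Nonempty)
    (h : DiscreteBounded (Mode.R '' K)) {b : EReal} (hb0 : 0 ≤ b)
    (hb : b < lyapunovDelta (fastModes K) 0) :
    ∀ᶠ ε : ℝ in 𝓝[>] 0, b < (ε : EReal) * lyapunovSigma K 0 ε := by
  -- Reals b < ρ < μ < ν < λ(Δ): μ is the spectral threshold, the gap to ν is for the Berger–Wang
  -- argument, and the gap to b keeps the final inequality strict.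
  obtain ⟨ν, hν1, hν2⟩ := EReal.lt_iff_exists_real_btwn.1 hb
  obtain ⟨μ, hμ1, hμ2⟩ := EReal.lt_iff_exists_real_btwn.1 hν1
  obtain ⟨ρ, hρ1, hρ2⟩ := EReal.lt_iff_exists_real_btwn.1 hμ1
  have hμν : μ < ν := by exact_mod_cast hμ2
  have hρμ : ρ < μ := by exact_mod_cast hρ2
  have hν0 : 0 ≤ ν := by exact_mod_cast hb0.trans hν1.le
  suffices ∀ᶠ ε : ℝ in 𝓝[>] 0, (ρ : EReal) ≤ (ε : EReal) * lyapunovSigma K 0 ε from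
    this.mono fun ε hε => hρ1.trans_le hε
  by_cases hmode : ∃ σ ∈ K, ∃ z ∈ complexSpectrum (NormedSpace.exp (fastGenerator σ)),
      Real.exp μ < ‖z‖
  · obtain ⟨σ, hσ, z, hz, hzμ⟩ := hmode
    exact eventually_le_mul_lyapunovSigma_of_mode hσ hz ((Real.exp_lt_exp.2 hρμ).trans hzμ)
  by_cases hword : ∃ l, IsPositive K l ∧ l ≠ [] ∧
      ∃ z ∈ complexSpectrum (word fastGenerator Mode.R l), Real.exp (μ * duration l) < ‖z‖
  · obtain ⟨l, hl, hl0, z, hz, hzμ⟩ := hword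
    refine eventually_le_mul_lyapunovSigma_of_word hne hl hl0 hz (lt_trans ?_ hzμ)
    exact Real.exp_lt_exp.2 (mul_lt_mul_of_pos_right hρμ (hl.duration_pos hl0))
  -- If no mode and no word exceeds rate μ spectrally, all flows of the limit system are O(e^{νt}),
  -- against ν < λ(Δ).
  push Not at hmode hword
  obtain ⟨C, M, hbM⟩ := h.exists_wordBound_fastGenerator hK
  obtain ⟨B, hB, hB'⟩ := hK.exists_norm_mode_le continuous_R
  obtain ⟨C₁, hC₁⟩ := exists_norm_exp_smul_le hK continuous_fastGenerator.continuousOn hμν hmode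
  obtain ⟨C', hbν⟩ := hbM.exists_of_spectrum hB' hν0 hμν hC₁ fun l hl z hz => by
    rcases eq_or_ne l [] with rfl | hl0
    · rw [eq_one_of_mem_complexSpectrum_one hz]
      simp
    · exact hword l hl hl0 z hz
  have := (wordBound_fastModes_iff.2 hbν).maxLyapunov_le
  exact absurd hν2 (not_lt.2 this)

end Modes

end SingPert

end

/-! ### The two bounds and the limit -/

theorem mainTheorem5 (d : ℕ) (hd : 2 ≤ d) (K : Set (SingPert.Mode d)) (hK : IsCompact K)
    (hne : K.Nonempty) :
    (Filter.liminf (fun ε : ℝ => (ε : EReal) * SingPert.lyapunovSigma K 0 ε)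
          (nhdsWithin 0 (Set.Ioi 0)) ≥
        (⨆ σ ∈ K, SingPert.spectralAbscissa (SingPert.fastGenerator σ)) ∧
      (0 : EReal) ≤ (⨆ σ ∈ K, SingPert.spectralAbscissa (SingPert.fastGenerator σ))) ∧
    (SingPert.DiscreteBounded (SingPert.Mode.R '' K) →
      Filter.Tendsto (fun ε : ℝ => (ε : EReal) * SingPert.lyapunovSigma K 0 ε)
        (nhdsWithin 0 (Set.Ioi 0))
        (nhds (max 0 (SingPert.lyapunovDelta (SingPert.fastModes K) 0)))) := by
  have hliminf : (⨆ σ ∈ K, SingPert.spectralAbscissa (SingPert.fastGenerator σ)) ≤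
      Filter.liminf (fun ε : ℝ => (ε : EReal) * SingPert.lyapunovSigma K 0 ε)
        (nhdsWithin 0 (Set.Ioi 0)) :=
    iSup₂_le fun σ hσ => SingPert.spectralAbscissa_le_liminf hσ
  have hnonneg : (0 : EReal) ≤ ⨆ σ ∈ K, SingPert.spectralAbscissa (SingPert.fastGenerator σ) := by
    obtain ⟨σ, hσ⟩ := hne
    exact le_iSup₂_of_le σ hσ (SingPert.spectralAbscissa_fastGenerator_nonneg hd σ)
  refine ⟨⟨hliminf, hnonneg⟩, fun h => tendsto_order.2 ⟨fun b hb => ?_, fun b hb =>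
    SingPert.eventually_mul_lyapunovSigma_lt hK h hb⟩⟩
  -- Levels below 0 are handled by the spectral abscissas; nonnegative levels below the maximum lie
  -- below λ(Δ).
  rcases lt_or_ge b 0 with hb0 | hb0
  · exact Filter.eventually_lt_of_lt_liminf (hb0.trans_le (hnonneg.trans hliminf))
  · refine SingPert.eventually_lt_mul_lyapunovSigma hK hne h hb0 ?_
    exact (lt_max_iff.1 hb).resolve_left (not_lt.2 hb0)
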